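/- For $T>0$ let $Q_T=\{(x,t): 0<x<1,\ 0<t\le T\}$ and $\overline Q_T=[0,1]\times[0,T]$. Given data $\Phi=(\varphi,F,E)$, a classical solution on $[0,T]$ of the inverse problem is a pair $(a,u)$ with $a\in C[0,T]$, $a>0$ on $[0,T]$, $u\in C^{2,1}(Q_T)\cap C^{1,0}(\overline Q_T)$, such that $$u_t=a(t)u_{xx}+F(x,t)\ \text{ in } Q_T,\qquad u(x,0)=\varphi(x)\ (0\le x\le 1),$$ $$u(0,t)=u(1,t),\quad u_x(1,t)=0,\quad \int_0^1u(x,t)\,dx=E(t)\qquad(0\le t\le T).$$ Let $Y_0(x)=x$, $Y_{2k-1}(x)=x\cos 2\pi kx$, $Y_{2k}(x)=\sin 2\pi kx$ for $k\ge1$, and put $\varphi_k=\int_0^1\varphi Y_k\,dx$, $F_k(t)=\int_0^1F(x,t)Y_k(x)\,dx$. The assumptions on the data are: (A1) $E\in C^1[0,T]$ and $E'(t)<0$ for all $t\in[0,T]$. (A2) $\varphi\in C^4[0,1]$; $\varphi(0)=\varphi(1)$, $\varphi'(1)=0$, $\varphi''(0)=\varphi''(1)$, $\int_0^1\varphi\,dx=E(0)$;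 and $\varphi_{2k}\ge0$ for $k\ge1$. (A3) $F\in C(\overline Q_T)$ and $F(\cdot,t)\in C^4[0,1]$ for every $t\in[0,T]$; $F(0,t)=F(1,t)$, $F_x(1,t)=0$, $F_{xx}(0,t)=F_{xx}(1,t)$ for every $t\in[0,T]$; $F_{2k}(t)\ge0$ for $k\ge0$, $t\in[0,T]$; and $$C_2(\Phi,T):=\int_0^TE'(t)\,dt+\sum_{k=1}^\infty\frac{2}{\pi k}\varphi_{2k}-2\int_0^TF_0(t)\,dt>0.$$ Put $\|\varphi\|_{C^4[0,1]}=\sum_{j=0}^4\sup_{[0,1]}|\varphi^{(j)}|$, $\|F\|_{C^{4,0}(\overline Q_T)}=\sum_{j=0}^4\sup_{\overline Q_T}|\partial_x^jF|$, $\|E\|_{C^1[0,T]}=\sup_{[0,T]}|E|+\sup_{[0,T]}|E'|$, and $\|\Phi\|=\|\varphi\|_{C^4[0,1]}+\|F\|_{C^{4,0}(\overline Q_T)}+\|E\|_{C^1[0,T]}$. **Theorem.** For all constants $M_1,M_2,M_3\ge0$ and $\delta>0$ there are $T_0>0$ and constants $M_{13},M_{14}$, depending only on $M_1,M_2,M_3,\delta$,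 such that the following holds for every $0<T\le T_0$. Let $\Phi=(\varphi,F,E)$ and $\overline\Phi=(\overline\varphi,\overline F,\overline E)$ satisfy (A1)–(A3) on $[0,T]$, with $$\|\varphi\|_{C^4[0,1]},\|\overline\varphi\|_{C^4[0,1]}\le M_1,\quad \|F\|_{C^{4,0}(\overline Q_T)},\|\overline F\|_{C^{4,0}(\overline Q_T)}\le M_2,\quad \|E\|_{C^1[0,T]},\|\overline E\|_{C^1[0,T]}\le M_3,$$ and $C_2(\Phi,T)\ge\delta$, $C_2(\overline\Phi,T)\ge\delta$. If $(a,u)$ and $(\overline a,\overline u)$ are classical solutions on $[0,T]$ of the inverse problem with data $\Phi$ and $\overline\Phi$ respectively, then $$\|a-\overline a\|_{C[0,T]}\le M_{13}\|\Phi-\overline\Phi\|,\qquad \|u-\overline u\|_{C(\overline Q_T)}\le M_{14}\|\Phi-\overline\Phi\|.$$ -/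

import Mathlib

open Set
open scoped NNReal ENNReal

noncomputable section

namespace HeatInverse

/-- The closed rectangle `[0,1] × [0,T]`. -/
def closedQ (T : ℝ) : Set (ℝ × ℝ) := Icc 0 1 ×ˢ Icc 0 T

/-- The domain `Q_T`, that is `0 < x < 1`, `0 < t ≤ T`. -/
def domQ (T : ℝ) : Set (ℝ × ℝ) := Ioo 0 1 ×ˢ Ioc 0 T

/-- The partial derivative in `x` on `[0,1]` (one-sided at the end points). -/
def dx (u : ℝ → ℝ → ℝ) (x t : ℝ) : ℝ := derivWithin (fun y => u y t) (Icc 0 1) x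

/-- The partial derivative in `t` on `[0,T]` (one-sided at the end points). -/
def dt (T : ℝ) (u : ℝ → ℝ → ℝ) (x t : ℝ) : ℝ := derivWithin (fun s => u x s) (Icc 0 T) t

/-- The sup norm of `f` on `s`, with values in `[0,∞]`. -/
def supNorm {α : Type*} (s : Set α) (f : α → ℝ) : ℝ≥0∞ := ⨆ z ∈ s, ‖f z‖ₑ

/-- The norm of `C^4[0,1]`: the sum of the sup norms of the derivatives of order `0, …, 4`. -/
def normC4 (φ : ℝ → ℝ) : ℝ≥0∞ :=
  ∑ j ∈ Finset.range 5, supNorm (Icc 0 1) (iteratedDerivWithin j φ (Icc 0 1))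

/-- The norm of `C^{4,0}` on `[0,1] × [0,T]`: the sum of the sup norms of the derivatives
in `x` of order `0, …, 4`. -/
def normC40 (T : ℝ) (F : ℝ → ℝ → ℝ) : ℝ≥0∞ :=
  ∑ j ∈ Finset.range 5, supNorm (closedQ T)
    (fun z => iteratedDerivWithin j (fun y => F y z.2) (Icc 0 1) z.1)

/-- The norm of `C^1[0,T]`. -/
def normC1 (T : ℝ) (E : ℝ → ℝ) : ℝ≥0∞ :=
  supNorm (Icc 0 T) E + supNorm (Icc 0 T) (derivWithin E (Icc 0 T))

/-- The functions `Y_0 = x`, `Y_{2k-1} = x cos 2πkx`, `Y_{2k} = sin 2πkx` (`k ≥ 1`).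
For `n = 2k - 1` one has `2k = n + 1`, and for `n = 2k` one has `2k = n`. -/
def Y (n : ℕ) (x : ℝ) : ℝ :=
  if n = 0 then x
  else if Even n then Real.sin (Real.pi * n * x)
  else x * Real.cos (Real.pi * (n + 1) * x)

/-- The coefficient `f_n = ∫₀¹ f(x) Y_n(x) dx`. -/
def coeffY (f : ℝ → ℝ) (n : ℕ) : ℝ := ∫ x in (0 : ℝ)..1, f x * Y n x

/-- The data `(φ, F, E)` of the inverse problem. -/
structure Data where
  φ : ℝ → ℝ
  F : ℝ → ℝ → ℝ
  E : ℝ → ℝ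

instance : Sub Data :=
  ⟨fun Φ Ψ => ⟨fun x => Φ.φ x - Ψ.φ x, fun x t => Φ.F x t - Ψ.F x t, fun t => Φ.E t - Ψ.E t⟩⟩

/-- `‖Φ‖ = ‖φ‖_{C^4[0,1]} + ‖F‖_{C^{4,0}} + ‖E‖_{C^1[0,T]}`. -/
def Data.norm (T : ℝ) (Φ : Data) : ℝ≥0∞ := normC4 Φ.φ + normC40 T Φ.F + normC1 T Φ.E

/-- `∫₀ᵀ E'(t) dt + ∑_{k ≥ 1} (2 / (π k)) φ_{2k} - 2 ∫₀ᵀ F_0(t) dt`. -/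
def Data.gap (T : ℝ) (Φ : Data) : ℝ :=
  (∫ t in (0 : ℝ)..T, derivWithin Φ.E (Icc 0 T) t)
    + (∑' k : ℕ, 2 / (Real.pi * (k + 1)) * coeffY Φ.φ (2 * (k + 1)))
    - 2 * ∫ t in (0 : ℝ)..T, coeffY (fun x => Φ.F x t) 0

/-- Assumption (A₁). -/
structure Data.A1 (T : ℝ) (Φ : Data) : Prop where
  contDiffOn : ContDiffOn ℝ 1 Φ.E (Icc 0 T)
  deriv_neg : ∀ t ∈ Icc 0 T, derivWithin Φ.E (Icc 0 T) t < 0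

/-- Assumption (A₂). -/
structure Data.A2 (Φ : Data) : Prop where
  contDiffOn : ContDiffOn ℝ 4 Φ.φ (Icc 0 1)
  periodic : Φ.φ 0 = Φ.φ 1
  deriv_one : derivWithin Φ.φ (Icc 0 1) 1 = 0
  deriv2_periodic :
    iteratedDerivWithin 2 Φ.φ (Icc 0 1) 0 = iteratedDerivWithin 2 Φ.φ (Icc 0 1) 1
  integral_eq : ∫ x in (0 : ℝ)..1, Φ.φ x = Φ.E 0
  coeff_nonneg : ∀ k : ℕ, 1 ≤ k → 0 ≤ coeffY Φ.φ (2 * k)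

/-- Assumption (A₃). -/
structure Data.A3 (T : ℝ) (Φ : Data) : Prop where
  continuousOn : ContinuousOn (fun z : ℝ × ℝ => Φ.F z.1 z.2) (closedQ T)
  contDiffOn : ∀ t ∈ Icc 0 T, ContDiffOn ℝ 4 (fun x => Φ.F x t) (Icc 0 1)
  periodic : ∀ t ∈ Icc 0 T, Φ.F 0 t = Φ.F 1 t
  deriv_one : ∀ t ∈ Icc 0 T, dx Φ.F 1 t = 0
  deriv2_periodic : ∀ t ∈ Icc 0 T,
    iteratedDerivWithin 2 (fun x => Φ.F x t) (Icc 0 1) 0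
      = iteratedDerivWithin 2 (fun x => Φ.F x t) (Icc 0 1) 1
  coeff_nonneg : ∀ k : ℕ, ∀ t ∈ Icc 0 T, 0 ≤ coeffY (fun x => Φ.F x t) (2 * k)
  gap_pos : 0 < Φ.gap T

/-- The data satisfy (A₁)–(A₃) on `[0,T]`. -/
structure Data.Admissible (T : ℝ) (Φ : Data) : Prop where
  a1 : Φ.A1 T
  a2 : Φ.A2
  a3 : Φ.A3 T

/-- The class `C^{1,0}` on `[0,1] × [0,T]`: `u` and `u_x` exist and are continuous. -/
structure IsC10 (T : ℝ) (u : ℝ → ℝ → ℝ) : Prop where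
  continuousOn : ContinuousOn (fun z : ℝ × ℝ => u z.1 z.2) (closedQ T)
  diff_x : ∀ z ∈ closedQ T, DifferentiableWithinAt ℝ (fun y => u y z.2) (Icc 0 1) z.1
  continuousOn_dx : ContinuousOn (fun z : ℝ × ℝ => dx u z.1 z.2) (closedQ T)

/-- The class `C^{2,1}(Q_T)`: `u`, `u_x`, `u_xx`, `u_t` exist and are continuous in `Q_T`. -/
structure IsC21 (T : ℝ) (u : ℝ → ℝ → ℝ) : Prop where
  continuousOn : ContinuousOn (fun z : ℝ × ℝ => u z.1 z.2) (domQ T)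
  diff_x : ∀ z ∈ domQ T, DifferentiableWithinAt ℝ (fun y => u y z.2) (Icc 0 1) z.1
  continuousOn_dx : ContinuousOn (fun z : ℝ × ℝ => dx u z.1 z.2) (domQ T)
  diff_xx : ∀ z ∈ domQ T, DifferentiableWithinAt ℝ (fun y => dx u y z.2) (Icc 0 1) z.1
  continuousOn_dxx : ContinuousOn (fun z : ℝ × ℝ => dx (dx u) z.1 z.2) (domQ T)
  diff_t : ∀ z ∈ domQ T, DifferentiableWithinAt ℝ (fun s => u z.1 s) (Icc 0 T) z.2
  continuousOn_dt : ContinuousOn (fun z : ℝ × ℝ => dt T u z.1 z.2) (domQ T)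

/-- `(a, u)` is a classical solution on `[0,T]` of the inverse problem with data `Φ`. -/
structure IsClassicalSolution (T : ℝ) (Φ : Data) (a : ℝ → ℝ) (u : ℝ → ℝ → ℝ) : Prop where
  a_continuousOn : ContinuousOn a (Icc 0 T)
  a_pos : ∀ t ∈ Icc 0 T, 0 < a t
  u_C21 : IsC21 T u
  u_C10 : IsC10 T u
  equation : ∀ x ∈ Ioo (0 : ℝ) 1, ∀ t ∈ Ioc 0 T, dt T u x t = a t * dx (dx u) x t + Φ.F x t
  initial : ∀ x ∈ Icc (0 : ℝ) 1, u x 0 = Φ.φ x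
  boundary_periodic : ∀ t ∈ Icc 0 T, u 0 t = u 1 t
  boundary_deriv : ∀ t ∈ Icc 0 T, dx u 1 t = 0
  overdetermination : ∀ t ∈ Icc 0 T, ∫ x in (0 : ℝ)..1, u x t = Φ.E t

end HeatInverse

end

/-! Write `ω_k = 2π(k+1)` and let `u_n` be the coefficients of `u(·,t)` against `Y_n`. Testing the
equation with `1` and using the overdetermination gives `a(t) u_x(0,t) = -E'(t) + ∫ F dx`, so
everything rests on a lower bound and a stability estimate for `u_x(0,t)`.

The sine coefficients satisfy the decoupled equations `u_{2k}' = -a (2πk)² u_{2k} + F_{2k}`. The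
sign assumptions give `u_{2k} ≥ 0`, and dropping the damping bounds `u_{2k}` by an envelope `σ` that
does not depend on `a` (`coeffY_even_nonneg`, `coeffY_even_le_envelope`). Two series identities,
`u_x(0,t) = 4 ∑ ω_k u_{2(k+1)}` and `E - 2u_0 = 4 ∑ u_{2(k+1)} / ω_k`, can be compared termwise
because `ω_k ≥ 1`. Since `E - 2u_0` decreases in time no further than the gap, `u_x(0,t) ≥ C₂ ≥ δ`
(`gap_le_dx_zero`), whence an upper bound `L` for `a` (`a_le`).

For two solutions let `N = max |a - b|` and let `D` bound the data difference. Duhamel-type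
comparison shows that the sine coefficients differ by at most `2D/ω^4 + T N ω² σ_k`. The
compatibility conditions and a weighted Bessel inequality give `∑ ω³ σ_k ≤ K₁ + K₂`; hence
`u_x(0,·)` differs by `O(D + T N)`. Inserting this in the formula for `a` yields `N δ ≤ O(D) + O(T
N)`, and a small `T` absorbs the last term (`stability`).

Finally `u - v` is recovered from its biorthogonal coefficients: `abs_le_of_coeffY` bounds the sup
norm by their absolute sums. The odd-indexed coefficients are forced by the sine coefficients and
are estimated by the same comparison principle. No lower bound for `a` is needed, since the
comparison only uses that the damping is nonnegative. -/

namespace HeatInverse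

/-! ### Real Fourier series on `[0,1]`. -/

/-- The frequency `2π(k+1)`. -/
noncomputable def freq (k : ℕ) : ℝ := 2 * Real.pi * (k + 1)

lemma six_mul_le_freq (k : ℕ) : 6 * ((k : ℝ) + 1) ≤ freq k := by
  have := Real.pi_gt_three
  have hk : (0 : ℝ) ≤ k := k.cast_nonneg
  unfold freq
  nlinarith

lemma one_le_freq (k : ℕ) : 1 ≤ freq k := by
  have := six_mul_le_freq k
  have hk : (0 : ℝ) ≤ k := k.cast_nonneg
  linarith

lemma freq_pos (k : ℕ) : 0 < freq k := zero_lt_one.trans_le (one_le_freq k)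

@[simp] lemma sin_freq (k : ℕ) : Real.sin (freq k) = 0 := by
  have := Real.sin_nat_mul_pi (2 * (k + 1))
  rw [← this, freq]; push_cast; congr 1; ring

@[simp] lemma cos_freq (k : ℕ) : Real.cos (freq k) = 1 := by
  have := Real.cos_nat_mul_two_pi (k + 1)
  rw [← this, freq]; push_cast; congr 1; ring

lemma sin_freq_mul_one_sub (k : ℕ) (x : ℝ) :
    Real.sin (freq k * (1 - x)) = -Real.sin (freq k * x) := by
  rw [mul_sub, mul_one, Real.sin_sub]; simp

lemma cos_freq_mul_one_sub (k : ℕ) (x : ℝ) :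
    Real.cos (freq k * (1 - x)) = Real.cos (freq k * x) := by
  rw [mul_sub, mul_one, Real.cos_sub]; simp

/-- The cosine coefficient `∫₀¹ g(x) cos(2π(k+1)x) dx`. -/
noncomputable def cosCoeff (g : ℝ → ℝ) (k : ℕ) : ℝ :=
  ∫ x in (0 : ℝ)..1, g x * Real.cos (freq k * x)

/-- The sine coefficient `∫₀¹ g(x) sin(2π(k+1)x) dx`. -/
noncomputable def sinCoeff (g : ℝ → ℝ) (k : ℕ) : ℝ :=
  ∫ x in (0 : ℝ)..1, g x * Real.sin (freq k * x)

lemma intervalIntegrable_mul {g f : ℝ → ℝ} (hg : ContinuousOn g (Icc 0 1)) (hf : Continuous f) :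
    IntervalIntegrable (fun x => g x * f x) MeasureTheory.volume 0 1 := by
  apply ContinuousOn.intervalIntegrable
  rw [uIcc_of_le zero_le_one]
  exact hg.mul hf.continuousOn

lemma continuous_cos_freq (k : ℕ) : Continuous fun x => Real.cos (freq k * x) := by fun_prop

lemma continuous_sin_freq (k : ℕ) : Continuous fun x => Real.sin (freq k * x) := by fun_prop

lemma intervalIntegrable_ofReal {f : ℝ → ℝ} {a b : ℝ}
    (h : IntervalIntegrable f MeasureTheory.volume a b) :
    IntervalIntegrable (fun x => (f x : ℂ)) MeasureTheory.volume a b :=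
  ⟨h.1.ofReal, h.2.ofReal⟩

lemma fourierCoeffOn_ofReal {g : ℝ → ℝ} (hg : ContinuousOn g (Icc 0 1)) (k : ℕ) (ε : ℤ)
    (hε : ε = 1 ∨ ε = -1) :
    fourierCoeffOn (zero_lt_one (α := ℝ)) (fun x => (g x : ℂ)) (ε * (k + 1))
      = cosCoeff g k - ε * Complex.I * sinCoeff g k := by
  rw [fourierCoeffOn_eq_integral, cosCoeff, sinCoeff, ← intervalIntegral.integral_ofReal,
    ← intervalIntegral.integral_ofReal, ← intervalIntegral.integral_const_mul,
    ← intervalIntegral.integral_sub]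
  · simp only [sub_zero, div_one, one_smul]
    refine intervalIntegral.integral_congr fun x _ => ?_
    have h : (fourier (-(ε * (k + 1))) (x : AddCircle (1 - 0 : ℝ)) : ℂ)
        = Complex.cos (freq k * x) - ε * Complex.I * Complex.sin (freq k * x) := by
      rw [fourier_coe_apply]
      have : 2 * (Real.pi : ℂ) * Complex.I * ((-(ε * (k + 1)) : ℤ) : ℂ) * x / ((1 - 0 : ℝ) : ℂ)
          = (-(ε * (freq k * x)) : ℂ) * Complex.I := by
        simp [freq]; ring
      rw [this, Complex.exp_mul_I]
      rcases hε with rfl | rfl <;> simp <;> ring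
    simp only [h, smul_eq_mul]
    push_cast
    ring
  · exact intervalIntegrable_ofReal (intervalIntegrable_mul hg (continuous_cos_freq k))
  · exact (intervalIntegrable_ofReal (intervalIntegrable_mul hg (continuous_sin_freq k))).const_mul _

lemma fourierCoeffOn_zero_ofReal (g : ℝ → ℝ) :
    fourierCoeffOn (zero_lt_one (α := ℝ)) (fun x => (g x : ℂ)) 0
      = (∫ x in (0 : ℝ)..1, g x : ℝ) := by
  rw [fourierCoeffOn_eq_integral, ← intervalIntegral.integral_ofReal]
  simp

/-- Pointwise convergence of the real Fourier series with absolutely summable coefficients. -/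
theorem hasSum_fourier_real {g : ℝ → ℝ} (hg : ContinuousOn g (Icc 0 1)) (hper : g 0 = g 1)
    (hc : Summable fun k => |cosCoeff g k|) (hs : Summable fun k => |sinCoeff g k|)
    {x : ℝ} (hx : x ∈ Ico (0 : ℝ) 1) :
    HasSum (fun k => 2 * (cosCoeff g k * Real.cos (freq k * x)
      + sinCoeff g k * Real.sin (freq k * x))) (g x - ∫ y in (0 : ℝ)..1, g y) := by
  have : Fact ((0 : ℝ) < 1) := ⟨zero_lt_one⟩
  set f : ℝ → ℂ := fun x => (g x : ℂ) with hf
  have hcont : Continuous (AddCircle.liftIco 1 0 f) :=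
    AddCircle.liftIco_zero_continuous (by simp [hf, hper])
      (Complex.continuous_ofReal.comp_continuousOn hg)
  set G : C(AddCircle (1 : ℝ), ℂ) := ⟨_, hcont⟩ with hG
  have hcoef : ∀ n, fourierCoeff G n = fourierCoeffOn (zero_lt_one (α := ℝ)) f n := by
    intro n
    have := fourierCoeff_liftIco_eq (T := 1) (a := 0) f n
    rw [fourierCoeffOn_eq_integral] at this ⊢
    simp only [hG, ContinuousMap.coe_mk, this]
    simp
  have hpos : ∀ k : ℕ, fourierCoeff G ((k : ℤ) + 1) = cosCoeff g k - Complex.I * sinCoeff g k := by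
    intro k
    rw [hcoef]
    simpa using fourierCoeffOn_ofReal hg k 1 (Or.inl rfl)
  have hneg : ∀ k : ℕ, fourierCoeff G (-((k : ℤ) + 1))
      = cosCoeff g k + Complex.I * sinCoeff g k := by
    intro k
    rw [hcoef]
    simpa using fourierCoeffOn_ofReal hg k (-1) (Or.inr rfl)
  have hcC : Summable fun k => (cosCoeff g k : ℂ) := Complex.ofRealCLM.summable hc.of_abs
  have hsC : Summable fun k => Complex.I * (sinCoeff g k : ℂ) :=
    (Complex.ofRealCLM.summable hs.of_abs).mul_left _
  have hsum : Summable (fourierCoeff G) := by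
    apply Summable.of_add_one_of_neg_add_one
    · simpa only [hpos] using hcC.sub hsC
    · simpa only [hneg] using hcC.add hsC
  have key : HasSum (fun n : ℕ => fourierCoeff G (n : ℤ) • fourier (n : ℤ) (x : AddCircle (1 : ℝ))
      + fourierCoeff G (-(n : ℤ)) • fourier (-(n : ℤ)) (x : AddCircle (1 : ℝ))) _ :=
    (has_pointwise_sum_fourier_series_of_summable hsum (x : AddCircle (1 : ℝ))).nat_add_neg
  -- `nat_add_neg` counts the frequency `0` twice and so sums to `G + c₀`; removing the index `0`,
  -- which contributes `2c₀`, leaves `G - c₀`.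
  have key1 := (hasSum_nat_add_iff' 1).mpr key
  have hGx : G (x : AddCircle (1 : ℝ)) = (g x : ℂ) := by
    simp only [hG, ContinuousMap.coe_mk]
    exact AddCircle.liftIco_zero_coe_apply hx
  have h0 : fourierCoeff G 0 = (∫ x in (0 : ℝ)..1, g x : ℝ) := by
    rw [hcoef, fourierCoeffOn_zero_ofReal]
  have hterm : ∀ k : ℕ, fourierCoeff G ((k + 1 : ℕ) : ℤ) • fourier ((k + 1 : ℕ) : ℤ) (x : AddCircle (1 : ℝ))
      + fourierCoeff G (-((k + 1 : ℕ) : ℤ)) • fourier (-((k + 1 : ℕ) : ℤ)) (x : AddCircle (1 : ℝ))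
      = ((2 * (cosCoeff g k * Real.cos (freq k * x)
        + sinCoeff g k * Real.sin (freq k * x)) : ℝ) : ℂ) := by
    intro k
    rw [fourier_coe_apply, fourier_coe_apply]
    have e1 : 2 * (Real.pi : ℂ) * Complex.I * (((k + 1 : ℕ) : ℤ) : ℂ) * x / ((1 : ℝ) : ℂ)
        = ((freq k * x : ℝ) : ℂ) * Complex.I := by simp [freq]; ring
    have e2 : 2 * (Real.pi : ℂ) * Complex.I * ((-((k + 1 : ℕ) : ℤ) : ℤ) : ℂ) * x / ((1 : ℝ) : ℂ)
        = ((-(freq k * x) : ℝ) : ℂ) * Complex.I := by simp [freq]; ring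
    have e3 : ((k + 1 : ℕ) : ℤ) = (k : ℤ) + 1 := by push_cast; ring
    rw [e1, e2, e3, hpos, hneg, Complex.exp_mul_I, Complex.exp_mul_I]
    simp only [smul_eq_mul, Complex.ofReal_neg, Complex.cos_neg, Complex.sin_neg]
    push_cast
    linear_combination (-2 * sinCoeff g k * Complex.sin (freq k * x)) * Complex.I_sq
  have hval : G (x : AddCircle (1 : ℝ)) + fourierCoeff G 0 • fourier 0 (x : AddCircle (1 : ℝ))
      - ∑ i ∈ Finset.range 1, (fourierCoeff G (i : ℤ) • fourier (i : ℤ) (x : AddCircle (1 : ℝ))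
        + fourierCoeff G (-(i : ℤ)) • fourier (-(i : ℤ)) (x : AddCircle (1 : ℝ)))
      = ((g x - ∫ y in (0 : ℝ)..1, g y : ℝ) : ℂ) := by
    simp [h0, hGx]
  rw [← Complex.hasSum_ofReal, ← hval]
  exact (funext hterm : _ = fun k : ℕ => ((2 * (cosCoeff g k * Real.cos (freq k * x)
    + sinCoeff g k * Real.sin (freq k * x)) : ℝ) : ℂ)) ▸ key1

lemma hasSum_fourier_real' {g : ℝ → ℝ} (hg : ContinuousOn g (Icc 0 1)) (hper : g 0 = g 1)
    (hc : Summable fun k => |cosCoeff g k|) (hs : Summable fun k => |sinCoeff g k|)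
    {x : ℝ} (hx : x ∈ Icc (0 : ℝ) 1) :
    HasSum (fun k => 2 * (cosCoeff g k * Real.cos (freq k * x)
      + sinCoeff g k * Real.sin (freq k * x))) (g x - ∫ y in (0 : ℝ)..1, g y) := by
  rcases hx.2.lt_or_eq with h | rfl
  · exact hasSum_fourier_real hg hper hc hs ⟨hx.1, h⟩
  · have := hasSum_fourier_real hg hper hc hs (x := 0) (by simp)
    simpa [hper] using this

lemma abs_le_of_fourier_coeff {g : ℝ → ℝ} (hg : ContinuousOn g (Icc 0 1)) (hper : g 0 = g 1)
    {A B C : ℝ} (hA : |∫ y in (0 : ℝ)..1, g y| ≤ A)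
    (hc : ∀ N, ∑ k ∈ Finset.range N, |cosCoeff g k| ≤ B)
    (hs : ∀ N, ∑ k ∈ Finset.range N, |sinCoeff g k| ≤ C)
    {x : ℝ} (hx : x ∈ Icc (0 : ℝ) 1) : |g x| ≤ A + 2 * B + 2 * C := by
  have hcs := summable_of_sum_range_le (fun _ => abs_nonneg _) hc
  have hss := summable_of_sum_range_le (fun _ => abs_nonneg _) hs
  have h := hasSum_fourier_real' hg hper hcs hss hx
  have hle : |g x - ∫ y in (0 : ℝ)..1, g y| ≤ 2 * B + 2 * C := by
    rw [← Real.norm_eq_abs]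
    refine le_of_tendsto h.tendsto_sum_nat.norm (Filter.Eventually.of_forall fun N => ?_)
    refine (norm_sum_le _ _).trans ?_
    calc ∑ k ∈ Finset.range N, ‖2 * (cosCoeff g k * Real.cos (freq k * x)
          + sinCoeff g k * Real.sin (freq k * x))‖
        ≤ ∑ k ∈ Finset.range N, (2 * |cosCoeff g k| + 2 * |sinCoeff g k|) := by
          refine Finset.sum_le_sum fun k _ => ?_
          rw [Real.norm_eq_abs, abs_mul, abs_two, ← mul_add]
          gcongr
          refine (abs_add_le _ _).trans (add_le_add ?_ ?_) <;> rw [abs_mul]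
          · exact mul_le_of_le_one_right (abs_nonneg _) (Real.abs_cos_le_one _)
          · exact mul_le_of_le_one_right (abs_nonneg _) (Real.abs_sin_le_one _)
      _ ≤ 2 * B + 2 * C := by
          rw [Finset.sum_add_distrib, ← Finset.mul_sum, ← Finset.mul_sum]
          linarith [hc N, hs N]
  have := abs_sub_abs_le_abs_sub (g x) (∫ y in (0 : ℝ)..1, g y)
  linarith

/-! ### Reflection `x ↦ 1 - x` and the biorthogonal coefficients. -/

lemma integral_comp_one_sub (f : ℝ → ℝ) :
    ∫ x in (0 : ℝ)..1, f (1 - x) = ∫ x in (0 : ℝ)..1, f x := by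
  rw [intervalIntegral.integral_comp_sub_left]; simp

lemma continuousOn_comp_one_sub {f : ℝ → ℝ} (hf : ContinuousOn f (Icc 0 1)) :
    ContinuousOn (fun x => f (1 - x)) (Icc 0 1) :=
  hf.comp (by fun_prop) fun x hx => ⟨by linarith [hx.2], by linarith [hx.1]⟩

lemma sinCoeff_comp_one_sub (f : ℝ → ℝ) (k : ℕ) :
    sinCoeff (fun x => f (1 - x)) k = -sinCoeff f k := by
  rw [sinCoeff, sinCoeff, ← integral_comp_one_sub, ← intervalIntegral.integral_neg]
  simp [sin_freq_mul_one_sub]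

lemma cosCoeff_comp_one_sub (f : ℝ → ℝ) (k : ℕ) :
    cosCoeff (fun x => f (1 - x)) k = cosCoeff f k := by
  rw [cosCoeff, cosCoeff, ← integral_comp_one_sub]
  simp [cos_freq_mul_one_sub]

lemma sinCoeff_add {f g : ℝ → ℝ} (hf : ContinuousOn f (Icc 0 1)) (hg : ContinuousOn g (Icc 0 1))
    (k : ℕ) : sinCoeff (fun x => f x + g x) k = sinCoeff f k + sinCoeff g k := by
  simp only [sinCoeff, add_mul]
  exact intervalIntegral.integral_add (intervalIntegrable_mul hf (continuous_sin_freq k))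
    (intervalIntegrable_mul hg (continuous_sin_freq k))

lemma cosCoeff_add {f g : ℝ → ℝ} (hf : ContinuousOn f (Icc 0 1)) (hg : ContinuousOn g (Icc 0 1))
    (k : ℕ) : cosCoeff (fun x => f x + g x) k = cosCoeff f k + cosCoeff g k := by
  simp only [cosCoeff, add_mul]
  exact intervalIntegral.integral_add (intervalIntegrable_mul hf (continuous_cos_freq k))
    (intervalIntegrable_mul hg (continuous_cos_freq k))

lemma intervalIntegrable_of_continuousOn {f : ℝ → ℝ} (hf : ContinuousOn f (Icc 0 1)) :
    IntervalIntegrable f MeasureTheory.volume 0 1 :=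
  ContinuousOn.intervalIntegrable (by rwa [uIcc_of_le zero_le_one])

/-- Value of the symmetrized cosine series at the end points. -/
theorem hasSum_cosCoeff_endpoints {f : ℝ → ℝ} (hf : ContinuousOn f (Icc 0 1))
    (hc : Summable fun k => |cosCoeff f k|) :
    HasSum (fun k => 4 * cosCoeff f k) (f 0 + f 1 - 2 * ∫ y in (0 : ℝ)..1, f y) := by
  have hf' := continuousOn_comp_one_sub hf
  -- The symmetrization takes equal values at `0` and `1` even if `f` does not, and its sine
  -- coefficients vanish. So only the cosine coefficients must be summable, and the series can be
  -- evaluated at `0`.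
  have h := hasSum_fourier_real' (g := fun x => f x + f (1 - x)) (hf.add hf')
    (by simp [add_comm]) (x := 0)
    (by simpa only [cosCoeff_add hf hf', cosCoeff_comp_one_sub f, ← two_mul, abs_mul]
          using hc.mul_left _)
    (by simpa only [sinCoeff_add hf hf', sinCoeff_comp_one_sub f, add_neg_cancel, abs_zero]
          using summable_zero) (by simp)
  simp only [cosCoeff_add hf hf', cosCoeff_comp_one_sub f] at h
  rw [intervalIntegral.integral_add (intervalIntegrable_of_continuousOn hf)
    (intervalIntegrable_of_continuousOn hf'), integral_comp_one_sub] at h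
  convert h using 1
  · funext k; simp; ring
  · simp; ring

lemma coeffY_zero (f : ℝ → ℝ) : coeffY f 0 = ∫ x in (0 : ℝ)..1, f x * x := by
  simp [coeffY, Y]

lemma coeffY_even (f : ℝ → ℝ) (k : ℕ) : coeffY f (2 * (k + 1)) = sinCoeff f k := by
  simp only [coeffY, Y, sinCoeff, freq]
  refine intervalIntegral.integral_congr fun x _ => ?_
  simp
  left; congr 1; ring

lemma coeffY_odd (f : ℝ → ℝ) (k : ℕ) : coeffY f (2 * k + 1) = cosCoeff (fun x => x * f x) k := by
  have h : ¬ Even (2 * k + 1) := by simp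
  simp only [coeffY, Y, cosCoeff, freq, h, if_false]
  refine intervalIntegral.integral_congr fun x _ => ?_
  simp only [Nat.add_eq_zero_iff, one_ne_zero, and_false, if_false]
  rw [show Real.pi * (((2 * k + 1 : ℕ) : ℝ) + 1) * x = 2 * Real.pi * (k + 1) * x by
    push_cast; ring]
  ring

lemma hasDerivAt_sin_mul (c x : ℝ) :
    HasDerivAt (fun x => Real.sin (c * x)) (c * Real.cos (c * x)) x :=
  ((hasDerivAt_id' x).const_mul c).sin.congr_deriv (by ring)

lemma hasDerivAt_cos_mul (c x : ℝ) :
    HasDerivAt (fun x => Real.cos (c * x)) (-(c * Real.sin (c * x))) x :=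
  ((hasDerivAt_id' x).const_mul c).cos.congr_deriv (by ring)

/-- Sup bound in terms of the coefficients with respect to the biorthogonal system. -/
theorem abs_le_of_coeffY {w : ℝ → ℝ} (hw : ContinuousOn w (Icc 0 1)) (hper : w 0 = w 1)
    {A B C : ℝ} (hA : |coeffY w 0| ≤ A)
    (hB : ∀ N, ∑ k ∈ Finset.range N, |coeffY w (2 * k + 1)| ≤ B)
    (hC : ∀ N, ∑ k ∈ Finset.range N, |coeffY w (2 * (k + 1))| ≤ C)
    {x : ℝ} (hx : x ∈ Icc (0 : ℝ) 1) : |w x| ≤ 2 * A + 4 * B + 4 * C := by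
  have hz : ContinuousOn (fun x => x * w x) (Icc 0 1) := continuousOn_id.mul hw
  have hz' := continuousOn_comp_one_sub hz
  have hw' : ContinuousOn (fun x => -w (1 - x)) (Icc 0 1) := (continuousOn_comp_one_sub hw).neg
  -- Split `w = P + (1 - x) q` with `P` symmetric and `q` antisymmetric under reflection. `P` has
  -- mean `2 * coeffY w 0` and only cosine coefficients, twice the odd-indexed `coeffY`; `q` has
  -- mean zero and only sine coefficients, twice the even-indexed ones.
  have hP := abs_le_of_fourier_coeff (g := fun x => x * w x + (1 - x) * w (1 - x))
    (A := 2 * A) (B := 2 * B) (C := 0) (hz.add hz') (by simp [hper]) ?_ ?_ ?_ hx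
  have hq := abs_le_of_fourier_coeff (g := fun x => w x + -w (1 - x))
    (A := 0) (B := 0) (C := 2 * C) (hw.add hw') (by simp [hper]) ?_ ?_ ?_ hx
  · have e : w x = (x * w x + (1 - x) * w (1 - x)) + (1 - x) * (w x + -w (1 - x)) := by ring
    have h1 : |(1 - x) * (w x + -w (1 - x))| ≤ |w x + -w (1 - x)| := by
      rw [abs_mul]
      refine mul_le_of_le_one_left (abs_nonneg _) ?_
      rw [abs_le]; constructor <;> linarith [hx.1, hx.2]
    have h2 := abs_add_le (x * w x + (1 - x) * w (1 - x)) ((1 - x) * (w x + -w (1 - x)))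
    rw [← e] at h2
    linarith
  · rw [intervalIntegral.integral_add (intervalIntegrable_of_continuousOn hw)
      (intervalIntegrable_of_continuousOn hw'), intervalIntegral.integral_neg,
      integral_comp_one_sub]
    simp
  · intro N
    refine (Finset.sum_nonpos fun k _ => ?_)
    rw [cosCoeff_add hw hw']
    have := cosCoeff_comp_one_sub w k
    have e : cosCoeff (fun x => -w (1 - x)) k = -cosCoeff (fun x => w (1 - x)) k := by
      simp [cosCoeff]
    rw [e, this]; simp
  · intro N
    rw [mul_comm]
    refine le_trans (le_of_eq ?_) (mul_le_mul_of_nonneg_right (hC N) zero_le_two)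
    rw [Finset.sum_mul]
    refine Finset.sum_congr rfl fun k _ => ?_
    have := sinCoeff_comp_one_sub w k
    have e : sinCoeff (fun x => -w (1 - x)) k = -sinCoeff (fun x => w (1 - x)) k := by
      simp [sinCoeff]
    rw [sinCoeff_add hw hw', e, this, neg_neg, coeffY_even, ← two_mul, abs_mul, abs_two, mul_comm]
  · rw [intervalIntegral.integral_add (intervalIntegrable_of_continuousOn hz)
      (intervalIntegrable_of_continuousOn hz'), integral_comp_one_sub (fun x => x * w x),
      ← two_mul, abs_mul, abs_two]
    rw [coeffY_zero] at hA
    simp only [mul_comm (w _)] at hA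
    linarith
  · intro N
    rw [mul_comm]
    refine le_trans (le_of_eq ?_) (mul_le_mul_of_nonneg_right (hB N) zero_le_two)
    rw [Finset.sum_mul]
    refine Finset.sum_congr rfl fun k _ => ?_
    rw [cosCoeff_add hz hz', cosCoeff_comp_one_sub (fun x => x * w x), coeffY_odd, ← two_mul,
      abs_mul, abs_two, mul_comm]
  · intro N
    refine (Finset.sum_nonpos fun k _ => ?_)
    rw [sinCoeff_add hz hz', sinCoeff_comp_one_sub (fun x => x * w x)]
    simp

/-! ### Integration by parts and the two series identities. -/

lemma freq_mul_cosCoeff {f f' : ℝ → ℝ} (hf : ContinuousOn f (Icc 0 1))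
    (hd : ∀ x ∈ Ioo (0 : ℝ) 1, HasDerivAt f (f' x) x) (hf' : ContinuousOn f' (Icc 0 1)) (k : ℕ) :
    freq k * cosCoeff f k = -sinCoeff f' k := by
  have h := intervalIntegral.integral_mul_deriv_eq_deriv_mul_of_hasDerivAt (a := 0) (b := 1)
    (u := f) (u' := f') (v := fun x => Real.sin (freq k * x))
    (v' := fun x => freq k * Real.cos (freq k * x))
    (by rwa [uIcc_of_le zero_le_one]) (by fun_prop) (by simpa using hd)
    (fun x _ => hasDerivAt_sin_mul _ x)
    (intervalIntegrable_of_continuousOn hf') (Continuous.intervalIntegrable (by fun_prop) _ _)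
  simp only [mul_one, sin_freq, mul_zero, Real.sin_zero, sub_zero, zero_sub] at h
  rw [sinCoeff, ← h, cosCoeff, ← intervalIntegral.integral_const_mul]
  congr 1; funext x; ring

lemma freq_mul_sinCoeff {f f' : ℝ → ℝ} (hf : ContinuousOn f (Icc 0 1))
    (hd : ∀ x ∈ Ioo (0 : ℝ) 1, HasDerivAt f (f' x) x) (hf' : ContinuousOn f' (Icc 0 1)) (k : ℕ) :
    freq k * sinCoeff f k = f 0 - f 1 + cosCoeff f' k := by
  have h := intervalIntegral.integral_mul_deriv_eq_deriv_mul_of_hasDerivAt (a := 0) (b := 1)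
    (u := f) (u' := f') (v := fun x => -Real.cos (freq k * x))
    (v' := fun x => freq k * Real.sin (freq k * x))
    (by rwa [uIcc_of_le zero_le_one]) (by fun_prop) (by simpa using hd)
    (fun x _ => (hasDerivAt_cos_mul _ x).neg.congr_deriv (by ring))
    (intervalIntegrable_of_continuousOn hf') (Continuous.intervalIntegrable (by fun_prop) _ _)
  simp only [mul_one, cos_freq, mul_zero, Real.cos_zero, mul_neg,
    intervalIntegral.integral_neg] at h
  rw [sinCoeff, cosCoeff, ← intervalIntegral.integral_const_mul]
  have e : ∫ x in (0 : ℝ)..1, freq k * (f x * Real.sin (freq k * x))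
      = ∫ x in (0 : ℝ)..1, f x * (freq k * Real.sin (freq k * x)) := by
    congr 1; funext x; ring
  rw [e, h]; ring

lemma sinCoeff_const (c : ℝ) (k : ℕ) : sinCoeff (fun _ => c) k = 0 := by
  have h := freq_mul_sinCoeff (f := fun _ => c) (f' := fun _ => 0) continuousOn_const
    (fun x _ => hasDerivAt_const x c) continuousOn_const k
  have h0 : cosCoeff (fun _ => 0) k = 0 := by simp [cosCoeff]
  rw [h0] at h
  simpa [(freq_pos k).ne'] using h

lemma integral_deriv_eq {f f' : ℝ → ℝ} (hf : ContinuousOn f (Icc 0 1))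
    (hd : ∀ x ∈ Ioo (0 : ℝ) 1, HasDerivAt f (f' x) x) (hf' : ContinuousOn f' (Icc 0 1)) :
    ∫ x in (0 : ℝ)..1, f' x = f 1 - f 0 :=
  intervalIntegral.integral_eq_sub_of_hasDerivAt_of_le zero_le_one hf hd
    (intervalIntegrable_of_continuousOn hf')

/-- The derivative at `0` as a sum of sine coefficients. -/
theorem hasSum_freq_mul_sinCoeff {f f' : ℝ → ℝ} (hf : ContinuousOn f (Icc 0 1))
    (hd : ∀ x ∈ Ioo (0 : ℝ) 1, HasDerivAt f (f' x) x) (hf' : ContinuousOn f' (Icc 0 1))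
    (hper : f 0 = f 1) (h1 : f' 1 = 0) (hs : Summable fun k => freq k * |sinCoeff f k|) :
    HasSum (fun k => 4 * (freq k * sinCoeff f k)) (f' 0) := by
  -- Equality of `f` at the end points removes the boundary term and also gives `∫ f' = 0`; with `f'
  -- 1 = 0` the endpoint formula applied to `f'` leaves only `f' 0`.
  have hc : ∀ k, cosCoeff f' k = freq k * sinCoeff f k := fun k => by
    rw [freq_mul_sinCoeff hf hd hf', hper]; ring
  have h := hasSum_cosCoeff_endpoints hf' (by
    refine hs.congr fun k => ?_
    rw [hc, abs_mul, abs_of_pos (freq_pos k)])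
  rw [integral_deriv_eq hf hd hf', hper, h1] at h
  simpa [hc] using h

/-- The moment `∫₀¹ (1 - 2x) f(x) dx` as a sum of sine coefficients. -/
theorem hasSum_sinCoeff_div_freq {f : ℝ → ℝ} (hf : ContinuousOn f (Icc 0 1))
    (hs : Summable fun k => |sinCoeff f k| / freq k) :
    HasSum (fun k => 4 * (sinCoeff f k / freq k))
      ((∫ x in (0 : ℝ)..1, f x) - 2 * coeffY f 0) := by
  set m := ∫ x in (0 : ℝ)..1, f x with hm
  -- A primitive of `f - m` that vanishes at both ends: its cosine coefficients are `-sinCoeff f k /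
  -- freq k`, and its mean is `m / 2 - coeffY f 0` by parts. The endpoint formula for `H` is then
  -- the claim.
  set H : ℝ → ℝ := fun x => (∫ y in (0 : ℝ)..x, f y) - x * m with hH
  have hfi : MeasureTheory.IntegrableOn f (Icc 0 1) := hf.integrableOn_Icc
  have hHc : ContinuousOn H (Icc 0 1) := by
    have := intervalIntegral.continuousOn_primitive_interval (f := f)
      (μ := MeasureTheory.volume) (a := 0) (b := 1) (by rwa [uIcc_of_le zero_le_one])
    rw [uIcc_of_le zero_le_one] at this
    exact this.sub (by fun_prop)
  have hHd : ∀ x ∈ Ioo (0 : ℝ) 1, HasDerivAt H (f x + -m) x := by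
    intro x hx
    have hx' : Icc (0 : ℝ) 1 ∈ nhds x := Icc_mem_nhds hx.1 hx.2
    have h1 := intervalIntegral.integral_hasDerivAt_right (f := f) (a := 0) (b := x)
      ((intervalIntegrable_of_continuousOn hf).mono_set (by
        rw [uIcc_of_le zero_le_one, uIcc_of_le hx.1.le]; exact Icc_subset_Icc le_rfl hx.2.le))
      ⟨Icc 0 1, hx', hf.aestronglyMeasurable measurableSet_Icc⟩ (hf.continuousAt hx')
    exact (h1.sub ((hasDerivAt_id' x).mul_const m)).congr_deriv (by ring)
  have hf' : ContinuousOn (fun x => f x + -m) (Icc 0 1) := hf.add continuousOn_const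
  have hc : ∀ k, cosCoeff H k = -(sinCoeff f k / freq k) := fun k => by
    have := freq_mul_cosCoeff hHc hHd hf' k
    rw [sinCoeff_add hf continuousOn_const, sinCoeff_const] at this
    have hp := (freq_pos k).ne'
    field_simp
    linarith
  have hH0 : H 0 = 0 := by simp [hH]
  have hH1 : H 1 = 0 := by simp [hH, hm]
  have h := hasSum_cosCoeff_endpoints hHc (by
    refine hs.congr fun k => ?_
    rw [hc, abs_neg, abs_div, abs_of_pos (freq_pos k)])
  have hI := intervalIntegral.integral_mul_deriv_eq_deriv_mul_of_hasDerivAt (a := 0) (b := 1)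
    (u := H) (u' := fun x => f x + -m) (v := fun x => x) (v' := fun _ => 1)
    (by rwa [uIcc_of_le zero_le_one]) (by fun_prop) (by simpa using hHd)
    (fun x _ => hasDerivAt_id x)
    (intervalIntegrable_of_continuousOn hf') (Continuous.intervalIntegrable (by fun_prop) _ _)
  have hI2 : ∫ x in (0 : ℝ)..1, (f x + -m) * x = coeffY f 0 - m / 2 := by
    have e : ∀ x, (f x + -m) * x = f x * x + -m * x := fun x => by ring
    simp only [e]
    rw [intervalIntegral.integral_add (intervalIntegrable_mul (f := fun x => x) hf (by fun_prop))
      (Continuous.intervalIntegrable (by fun_prop) _ _), coeffY_zero,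
      intervalIntegral.integral_const_mul, integral_id]
    ring
  simp only [mul_one, hH0, hH1, mul_zero, sub_zero, zero_sub, hI2] at hI
  rw [hH0, hH1, hI] at h
  convert! h.neg using 1
  · funext k; rw [hc]; ring
  · ring

/-! ### Orthogonality of sines and a weighted Bessel inequality. -/

/-- Integrating by parts twice gives the factor `freq k ^ 2 - freq j ^ 2` times the integral equal
to zero. On the diagonal one integration by parts identifies the sine and cosine integrals, whose
sum is `1`. -/
lemma sinCoeff_sin (j k : ℕ) :
    sinCoeff (fun x => Real.sin (freq j * x)) k = if j = k then 1 / 2 else 0 := by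
  have h1 := freq_mul_sinCoeff (f := fun x => Real.sin (freq j * x))
    (f' := fun x => freq j * Real.cos (freq j * x)) (by fun_prop) (fun x _ => hasDerivAt_sin_mul _ x)
    (by fun_prop) k
  have h2 := freq_mul_cosCoeff (f := fun x => freq j * Real.cos (freq j * x))
    (f' := fun x => -freq j ^ 2 * Real.sin (freq j * x)) (by fun_prop) (fun x _ =>
      ((hasDerivAt_cos_mul _ x).const_mul _).congr_deriv (by ring)) (by fun_prop) k
  have e1 : sinCoeff (fun x => -freq j ^ 2 * Real.sin (freq j * x)) k
      = -freq j ^ 2 * sinCoeff (fun x => Real.sin (freq j * x)) k := by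
    simp only [sinCoeff, mul_assoc, intervalIntegral.integral_const_mul]
  have e2 : cosCoeff (fun x => freq j * Real.cos (freq j * x)) k
      = freq j * cosCoeff (fun x => Real.cos (freq j * x)) k := by
    simp only [cosCoeff, mul_assoc, intervalIntegral.integral_const_mul]
  rw [e2] at h1 h2
  rw [e1] at h2
  simp only [mul_zero, mul_one, Real.sin_zero, sin_freq, sub_zero, zero_add] at h1
  have hj := freq_pos j
  have hk := freq_pos k
  split_ifs with hjk
  · subst hjk
    have h3 : sinCoeff (fun x => Real.sin (freq j * x)) j
        = cosCoeff (fun x => Real.cos (freq j * x)) j := mul_left_cancel₀ hj.ne' h1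
    have h4 : sinCoeff (fun x => Real.sin (freq j * x)) j
        + cosCoeff (fun x => Real.cos (freq j * x)) j = 1 := by
      rw [sinCoeff, cosCoeff, ← intervalIntegral.integral_add
        (Continuous.intervalIntegrable (by fun_prop) _ _)
        (Continuous.intervalIntegrable (by fun_prop) _ _)]
      simp only [← pow_two, Real.sin_sq_add_cos_sq]
      simp
    linarith
  · have h3 : (freq k ^ 2 - freq j ^ 2) * sinCoeff (fun x => Real.sin (freq j * x)) k = 0 := by
      linear_combination freq k * h1 + h2
    rcases mul_eq_zero.mp h3 with h | h
    · exfalso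
      apply hjk
      have h4 : freq k = freq j := by
        nlinarith [sq_nonneg (freq k - freq j)]
      simp only [freq] at h4
      have h5 := mul_left_cancel₀ (by positivity) h4
      have : (k : ℝ) = j := by linarith
      exact (Nat.cast_injective this).symm
    · exact h

lemma sum_inv_sq_le_two (N : ℕ) : ∑ k ∈ Finset.range N, 1 / ((k : ℝ) + 1) ^ 2 ≤ 2 := by
  have h : ∀ N : ℕ, ∑ k ∈ Finset.range (N + 1), 1 / ((k : ℝ) + 1) ^ 2 ≤ 2 - 1 / ((N : ℝ) + 1) := by
    intro N
    induction N with
    | zero => norm_num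
    | succ n ih =>
      rw [Finset.sum_range_succ]
      have : 1 / (((n + 1 : ℕ) : ℝ) + 1) ^ 2
          ≤ 1 / ((n : ℝ) + 1) - 1 / (((n + 1 : ℕ) : ℝ) + 1) := by
        push_cast
        rw [div_sub_div _ _ (by positivity) (by positivity),
          div_le_div_iff₀ (by positivity) (by positivity)]
        nlinarith [(Nat.cast_nonneg n : (0 : ℝ) ≤ n)]
      linarith
  rcases N with _ | N
  · simp
  · have := h N
    have h2 : (0 : ℝ) ≤ 1 / ((N : ℝ) + 1) := by positivity
    linarith

/-- Weighted Bessel inequality for the sine coefficients of a bounded function. -/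
theorem sum_abs_sinCoeff_div_le {g : ℝ → ℝ} (hg : ContinuousOn g (Icc 0 1)) {K : ℝ}
    (hK : ∀ x ∈ Icc (0 : ℝ) 1, |g x| ≤ K) (N : ℕ) :
    ∑ k ∈ Finset.range N, |sinCoeff g k| / (k + 1) ≤ K := by
  have hK0 : 0 ≤ K := (abs_nonneg _).trans (hK 0 (by simp))
  -- Duality: the weighted sum is `∫ g S` for the sine polynomial `S` with these coefficients.
  -- Orthogonality gives `∫ S² ≤ 1`, and `|g S| ≤ K / 2 + K / 2 * S²` replaces Cauchy–Schwarz.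
  set c : ℕ → ℝ := fun k => SignType.sign (sinCoeff g k) / ((k : ℝ) + 1) with hc
  set S : ℝ → ℝ := fun x => ∑ k ∈ Finset.range N, c k * Real.sin (freq k * x) with hS
  have hSc : Continuous S := by fun_prop
  have hsum : ∑ k ∈ Finset.range N, |sinCoeff g k| / (k + 1) = ∫ x in (0 : ℝ)..1, g x * S x := by
    simp only [hS, Finset.mul_sum]
    rw [intervalIntegral.integral_finsetSum]
    · refine Finset.sum_congr rfl fun k _ => ?_
      simp only [mul_left_comm (g _), intervalIntegral.integral_const_mul]
      rw [← sign_mul_self]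
      simp only [hc, sinCoeff]
      ring
    · intro k _
      exact intervalIntegrable_mul hg (by fun_prop)
  have hSS : ∫ x in (0 : ℝ)..1, S x * S x ≤ 1 := by
    have e : ∫ x in (0 : ℝ)..1, S x * S x
        = ∑ j ∈ Finset.range N, c j * ∑ k ∈ Finset.range N, c k * (if k = j then 1 / 2 else 0) := by
      have e1 : ∀ x, S x * S x = ∑ j ∈ Finset.range N, c j * ∑ k ∈ Finset.range N,
          c k * (Real.sin (freq k * x) * Real.sin (freq j * x)) := by
        intro x
        simp only [hS]
        rw [Finset.sum_mul_sum, Finset.sum_comm]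
        refine Finset.sum_congr rfl fun j _ => ?_
        rw [Finset.mul_sum]
        refine Finset.sum_congr rfl fun k _ => ?_
        ring
      simp only [e1]
      rw [intervalIntegral.integral_finsetSum
        (fun j _ => Continuous.intervalIntegrable (by fun_prop) _ _)]
      refine Finset.sum_congr rfl fun j _ => ?_
      rw [intervalIntegral.integral_const_mul, intervalIntegral.integral_finsetSum
        (fun j _ => Continuous.intervalIntegrable (by fun_prop) _ _)]
      congr 1
      refine Finset.sum_congr rfl fun k _ => ?_
      rw [intervalIntegral.integral_const_mul, ← sinCoeff_sin k j, sinCoeff]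
    rw [e]
    have h2 := sum_inv_sq_le_two N
    calc _ ≤ ∑ j ∈ Finset.range N, (1 / 2) * (1 / ((j : ℝ) + 1) ^ 2) := by
          refine Finset.sum_le_sum fun j hj => ?_
          rw [Finset.sum_eq_single_of_mem j hj (fun k _ hk => by simp [hk])]
          simp only [if_true, hc]
          have hs : (SignType.sign (sinCoeff g j) : ℝ) * SignType.sign (sinCoeff g j) ≤ 1 := by
            rcases SignType.sign (sinCoeff g j) with _ | _ | _ <;> simp
          have : (0 : ℝ) ≤ (1 / 2) * (1 / ((j : ℝ) + 1) ^ 2) := by positivity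
          calc _ = ((SignType.sign (sinCoeff g j) : ℝ) * SignType.sign (sinCoeff g j))
                * ((1 / 2) * (1 / ((j : ℝ) + 1) ^ 2)) := by field_simp
            _ ≤ 1 * ((1 / 2) * (1 / ((j : ℝ) + 1) ^ 2)) := by gcongr
            _ = _ := one_mul _
      _ ≤ 1 := by rw [← Finset.mul_sum]; linarith
  rw [hsum]
  calc ∫ x in (0 : ℝ)..1, g x * S x ≤ ∫ x in (0 : ℝ)..1, (K / 2 + K / 2 * (S x * S x)) := by
        refine intervalIntegral.integral_mono_on zero_le_one (intervalIntegrable_mul hg hSc)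
          (Continuous.intervalIntegrable (by fun_prop) _ _) fun x hx => ?_
        have h1 := hK x hx
        have h2 : g x * S x ≤ K * |S x| := (le_abs_self _).trans (by rw [abs_mul]; gcongr)
        have h3 : |S x| ≤ 1 / 2 + 1 / 2 * (S x * S x) := by
          rw [← abs_mul_abs_self (S x)]; nlinarith [sq_nonneg (|S x| - 1)]
        nlinarith
    _ = K / 2 + K / 2 * ∫ x in (0 : ℝ)..1, S x * S x := by
        rw [intervalIntegral.integral_add (by simp)
          (Continuous.intervalIntegrable (by fun_prop) _ _), intervalIntegral.integral_const_mul]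
        simp
    _ ≤ K := by nlinarith

/-! ### Decay of the coefficients of compatible `C^4` functions. -/

/-- Functions of class `C^4` that satisfy the compatibility conditions at the end points. -/
structure Compatible (f : ℝ → ℝ) : Prop where
  contDiffOn : ContDiffOn ℝ 4 f (Icc 0 1)
  periodic : f 0 = f 1
  deriv_one : derivWithin f (Icc 0 1) 1 = 0
  deriv2_periodic :
    iteratedDerivWithin 2 f (Icc 0 1) 0 = iteratedDerivWithin 2 f (Icc 0 1) 1

lemma uniqueDiffOn_unit : UniqueDiffOn ℝ (Icc (0 : ℝ) 1) := uniqueDiffOn_Icc zero_lt_one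

lemma Compatible.sub {f g : ℝ → ℝ} (hf : Compatible f) (hg : Compatible g) :
    Compatible (fun x => f x - g x) where
  contDiffOn := hf.contDiffOn.sub hg.contDiffOn
  periodic := by rw [hf.periodic, hg.periodic]
  deriv_one := by
    have h1 : (1 : ℝ) ∈ Icc (0 : ℝ) 1 := by simp
    rw [derivWithin_fun_sub (hf.contDiffOn.differentiableOn (by norm_num) 1 h1)
      (hg.contDiffOn.differentiableOn (by norm_num) 1 h1), hf.deriv_one, hg.deriv_one, sub_zero]
  deriv2_periodic := by
    have h1 : (1 : ℝ) ∈ Icc (0 : ℝ) 1 := by simp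
    have h0 : (0 : ℝ) ∈ Icc (0 : ℝ) 1 := by simp
    have hf2 : ContDiffOn ℝ 2 f (Icc 0 1) := hf.contDiffOn.of_le (by norm_num)
    have hg2 : ContDiffOn ℝ 2 g (Icc 0 1) := hg.contDiffOn.of_le (by norm_num)
    change iteratedDerivWithin 2 (f - g) (Icc 0 1) 0 = iteratedDerivWithin 2 (f - g) (Icc 0 1) 1
    rw [iteratedDerivWithin_sub h0 uniqueDiffOn_unit (hf2 0 h0) (hg2 0 h0),
      iteratedDerivWithin_sub h1 uniqueDiffOn_unit (hf2 1 h1) (hg2 1 h1),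
      hf.deriv2_periodic, hg.deriv2_periodic]

lemma Compatible.continuousOn_deriv {f : ℝ → ℝ} (hf : Compatible f) {j : ℕ} (hj : j ≤ 4) :
    ContinuousOn (iteratedDerivWithin j f (Icc 0 1)) (Icc 0 1) :=
  hf.contDiffOn.continuousOn_iteratedDerivWithin (by exact_mod_cast hj) uniqueDiffOn_unit

lemma Compatible.hasDerivAt {f : ℝ → ℝ} (hf : Compatible f) {j : ℕ} (hj : j < 4) {x : ℝ}
    (hx : x ∈ Ioo (0 : ℝ) 1) :
    HasDerivAt (iteratedDerivWithin j f (Icc 0 1)) (iteratedDerivWithin (j + 1) f (Icc 0 1) x) x := by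
  have h := hf.contDiffOn.differentiableOn_iteratedDerivWithin (m := j)
    (by exact_mod_cast hj) uniqueDiffOn_unit x (Ioo_subset_Icc_self hx)
  rw [iteratedDerivWithin_succ]
  exact h.hasDerivWithinAt.hasDerivAt (Icc_mem_nhds hx.1 hx.2)

lemma abs_integral_le_of_abs_le {f : ℝ → ℝ} {K : ℝ} (h : ∀ x ∈ Icc (0 : ℝ) 1, |f x| ≤ K) :
    |∫ x in (0 : ℝ)..1, f x| ≤ K := by
  have := intervalIntegral.norm_integral_le_of_norm_le_const (a := 0) (b := 1) (f := f) (C := K)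
    (fun x hx => h x (by rw [uIoc_of_le zero_le_one] at hx; exact Ioc_subset_Icc_self hx))
  simpa using this

lemma abs_integral_mul_le {f g : ℝ → ℝ} {K : ℝ} (h : ∀ x ∈ Icc (0 : ℝ) 1, |f x| ≤ K)
    (hg : ∀ x ∈ Icc (0 : ℝ) 1, |g x| ≤ 1) : |∫ x in (0 : ℝ)..1, f x * g x| ≤ K :=
  abs_integral_le_of_abs_le fun x hx => by
    rw [abs_mul]
    exact (mul_le_of_le_one_right (abs_nonneg _) (hg x hx)).trans (h x hx)

lemma abs_sinCoeff_le {f : ℝ → ℝ} {K : ℝ} (h : ∀ x ∈ Icc (0 : ℝ) 1, |f x| ≤ K) (k : ℕ) :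
    |sinCoeff f k| ≤ K :=
  abs_integral_mul_le h fun _ _ => Real.abs_sin_le_one _

lemma abs_cosCoeff_le {f : ℝ → ℝ} {K : ℝ} (h : ∀ x ∈ Icc (0 : ℝ) 1, |f x| ≤ K) (k : ℕ) :
    |cosCoeff f k| ≤ K :=
  abs_integral_mul_le h fun _ _ => Real.abs_cos_le_one _

lemma abs_coeffY_zero_le {f : ℝ → ℝ} {K : ℝ} (h : ∀ x ∈ Icc (0 : ℝ) 1, |f x| ≤ K) :
    |coeffY f 0| ≤ K := by
  rw [coeffY_zero]
  exact abs_integral_mul_le h fun x hx => by rw [abs_of_nonneg hx.1]; exact hx.2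

/-- Four integrations by parts: those starting from a cosine coefficient have no boundary term, and
the other two have the boundary terms `f 0 - f 1` and `f'' 0 - f'' 1`, which vanish. -/
lemma Compatible.freq_pow_mul_sinCoeff {f : ℝ → ℝ} (hf : Compatible f) (k : ℕ) :
    freq k ^ 4 * sinCoeff f k = sinCoeff (iteratedDerivWithin 4 f (Icc 0 1)) k := by
  have h0 := freq_mul_sinCoeff (hf.continuousOn_deriv (j := 0) (by norm_num))
    (fun x hx => hf.hasDerivAt (by norm_num) hx) (hf.continuousOn_deriv (by norm_num)) k
  have h1 := freq_mul_cosCoeff (hf.continuousOn_deriv (j := 1) (by norm_num))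
    (fun x hx => hf.hasDerivAt (by norm_num) hx) (hf.continuousOn_deriv (by norm_num)) k
  have h2 := freq_mul_sinCoeff (hf.continuousOn_deriv (j := 2) (by norm_num))
    (fun x hx => hf.hasDerivAt (by norm_num) hx) (hf.continuousOn_deriv (by norm_num)) k
  have h3 := freq_mul_cosCoeff (hf.continuousOn_deriv (j := 3) (by norm_num))
    (fun x hx => hf.hasDerivAt (by norm_num) hx) (hf.continuousOn_deriv (by norm_num)) k
  simp only [iteratedDerivWithin_zero, Nat.reduceAdd] at h0 h1 h2 h3
  have hp := hf.periodic
  have hp2 := hf.deriv2_periodic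
  linear_combination freq k ^ 3 * h0 + freq k ^ 2 * h1 - freq k * h2 - h3
    + freq k ^ 3 * hp - freq k * hp2

lemma Compatible.abs_freq_pow_mul_coeffY_odd_le {f : ℝ → ℝ} (hf : Compatible f) {K : ℝ}
    (hK : ∀ j ≤ 4, ∀ x ∈ Icc (0 : ℝ) 1, |iteratedDerivWithin j f (Icc 0 1) x| ≤ K) (k : ℕ) :
    freq k ^ 4 * |coeffY f (2 * k + 1)| ≤ 12 * K := by
  have hc : ∀ j ≤ 4, ContinuousOn (iteratedDerivWithin j f (Icc 0 1)) (Icc 0 1) :=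
    fun j hj => hf.continuousOn_deriv hj
  set D := fun j => iteratedDerivWithin j f (Icc 0 1) with hD
  have hd : ∀ j < 4, ∀ x ∈ Ioo (0 : ℝ) 1, HasDerivAt (D j) (D (j + 1) x) x :=
    fun j hj x hx => hf.hasDerivAt hj hx
  -- Leibniz formula for the `j`-th derivative of `x * f x`; the truncated `j - 1` at `j = 0` is
  -- harmless because of the factor `j`.
  set G : ℕ → ℝ → ℝ := fun j x => j * D (j - 1) x + x * D j x with hG
  have hGc : ∀ j ≤ 4, ContinuousOn (G j) (Icc 0 1) := fun j hj =>
    (continuousOn_const.mul (hc _ (by omega))).add (continuousOn_id.mul (hc j hj))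
  have hGd : ∀ j < 4, ∀ x ∈ Ioo (0 : ℝ) 1, HasDerivAt (G j) (G (j + 1) x) x := by
    intro j hj x hx
    have h1 := (hasDerivAt_id' x).mul (hd j hj x hx)
    rcases j with _ | j
    · refine (h1.congr_deriv ?_).congr_of_eventuallyEq (Filter.Eventually.of_forall fun y => ?_)
      · simp [hG]
      · simp [hG]
    · refine (((hd j (by omega) x hx).const_mul ((j + 1 : ℕ) : ℝ)).add h1).congr_deriv ?_
      simp only [hG, Nat.add_sub_cancel]
      push_cast
      ring
  have h0 := freq_mul_cosCoeff (hGc 0 (by norm_num)) (hGd 0 (by norm_num)) (hGc 1 (by norm_num)) k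
  have h1 := freq_mul_sinCoeff (hGc 1 (by norm_num)) (hGd 1 (by norm_num)) (hGc 2 (by norm_num)) k
  have h2 := freq_mul_cosCoeff (hGc 2 (by norm_num)) (hGd 2 (by norm_num)) (hGc 3 (by norm_num)) k
  have h3 := freq_mul_sinCoeff (hGc 3 (by norm_num)) (hGd 3 (by norm_num)) (hGc 4 (by norm_num)) k
  have e0 : cosCoeff (G 0) k = coeffY f (2 * k + 1) := by
    rw [coeffY_odd]; simp [hG, hD]
  have e1 : G 1 0 = G 1 1 := by
    simp [hG, hD, iteratedDerivWithin_one, hf.deriv_one, hf.periodic]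
  -- The first boundary term cancels by `f 0 = f 1` and `f' 1 = 0`. The third-order one remains and
  -- costs `3K + 4K`; together with `5K` from `G 4` this makes the constant `12`.
  have key : freq k ^ 4 * coeffY f (2 * k + 1) = G 3 0 - G 3 1 + cosCoeff (G 4) k := by
    rw [e0] at h0
    linear_combination freq k ^ 3 * h0 - freq k ^ 2 * h1 - freq k ^ 2 * e1 - freq k * h2 + h3
  have hGb : ∀ j ≤ 4, ∀ x ∈ Icc (0 : ℝ) 1, |G j x| ≤ j * K + |x| * K := by
    intro j hj x hx
    refine (abs_add_le _ _).trans (add_le_add ?_ ?_)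
    · rw [abs_mul, Nat.abs_cast]
      exact mul_le_mul_of_nonneg_left (hK _ (by omega) x hx) (by positivity)
    · rw [abs_mul]
      exact mul_le_mul_of_nonneg_left (hK j hj x hx) (abs_nonneg _)
  have hK0 : 0 ≤ K := (abs_nonneg _).trans (hK 0 (by norm_num) 0 (by simp))
  have b1 := hGb 3 (by norm_num) 0 (by simp)
  have b2 := hGb 3 (by norm_num) 1 (by simp)
  have b3 := abs_cosCoeff_le (f := G 4) (K := 5 * K) (fun x hx => by
    refine (hGb 4 le_rfl x hx).trans ?_
    rw [abs_of_nonneg hx.1]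
    push_cast
    nlinarith [hx.2]) k
  have hp : freq k ^ 4 * |coeffY f (2 * k + 1)| = |freq k ^ 4 * coeffY f (2 * k + 1)| := by
    rw [abs_mul, abs_of_pos (pow_pos (freq_pos k) 4)]
  rw [hp, key]
  have t1 := abs_add_le (G 3 0 - G 3 1) (cosCoeff (G 4) k)
  have t2 := abs_sub (G 3 0) (G 3 1)
  simp only [abs_zero, abs_one] at b1 b2
  push_cast at b1 b2
  linarith

lemma Compatible.freq_pow_mul_abs_sinCoeff_le {f : ℝ → ℝ} (hf : Compatible f) {K : ℝ}
    (hK : ∀ x ∈ Icc (0 : ℝ) 1, |iteratedDerivWithin 4 f (Icc 0 1) x| ≤ K) (k : ℕ) :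
    freq k ^ 4 * |sinCoeff f k| ≤ K := by
  have := abs_sinCoeff_le hK k
  rwa [← hf.freq_pow_mul_sinCoeff, abs_mul, abs_of_pos (pow_pos (freq_pos k) 4)] at this

/-- The pointwise decay `freq k ^ (-4)` would leave a harmonic series here. Bessel's inequality for
the fourth derivative, with weight `1 / (k + 1)`, gains what is missing. -/
lemma Compatible.sum_freq_pow_mul_abs_sinCoeff_le {f : ℝ → ℝ} (hf : Compatible f) {K : ℝ}
    (hK : ∀ x ∈ Icc (0 : ℝ) 1, |iteratedDerivWithin 4 f (Icc 0 1) x| ≤ K) (N : ℕ) :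
    ∑ k ∈ Finset.range N, freq k ^ 3 * |sinCoeff f k| ≤ K := by
  refine le_trans (Finset.sum_le_sum fun k _ => ?_)
    (sum_abs_sinCoeff_div_le (hf.continuousOn_deriv le_rfl) hK N)
  have hk : (0 : ℝ) < k + 1 := by positivity
  have h6 := six_mul_le_freq k
  rw [← hf.freq_pow_mul_sinCoeff, abs_mul, abs_of_pos (pow_pos (freq_pos k) 4), le_div_iff₀ hk]
  have : 0 ≤ freq k ^ 3 * |sinCoeff f k| := by have := freq_pos k; positivity
  calc freq k ^ 3 * |sinCoeff f k| * (k + 1) ≤ freq k ^ 3 * |sinCoeff f k| * freq k := by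
        gcongr; linarith
    _ = _ := by ring

lemma sum_one_div_freq_sq_le (N : ℕ) : ∑ k ∈ Finset.range N, 1 / freq k ^ 2 ≤ 1 := by
  calc ∑ k ∈ Finset.range N, 1 / freq k ^ 2
      ≤ ∑ k ∈ Finset.range N, (1 / 36) * (1 / ((k : ℝ) + 1) ^ 2) := by
        refine Finset.sum_le_sum fun k _ => ?_
        have h6 := six_mul_le_freq k
        have : (0 : ℝ) < k + 1 := by positivity
        rw [one_div_mul_one_div]
        apply one_div_le_one_div_of_le (by positivity)
        nlinarith
    _ ≤ 1 := by
        rw [← Finset.mul_sum]; linarith [sum_inv_sq_le_two N]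

/-! ### Moments of a solution as differentiable functions of time. -/

/-- The retraction of the line onto `[0,b]`. -/
def clamp (b x : ℝ) : ℝ := max 0 (min b x)

lemma clamp_mem {b : ℝ} (hb : 0 ≤ b) (x : ℝ) : clamp b x ∈ Icc 0 b :=
  ⟨le_max_left _ _, max_le hb (min_le_left _ _)⟩

lemma clamp_of_mem {b x : ℝ} (hx : x ∈ Icc 0 b) : clamp b x = x := by
  rw [clamp, min_eq_right hx.2, max_eq_right hx.1]

lemma continuous_clamp (b : ℝ) : Continuous (clamp b) := by
  unfold clamp; fun_prop

lemma exists_continuous_extension {T : ℝ} (hT : 0 ≤ T) {f : ℝ → ℝ → ℝ}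
    (hf : ContinuousOn (fun z : ℝ × ℝ => f z.1 z.2) (closedQ T)) :
    ∃ g : ℝ → ℝ → ℝ, (Continuous fun z : ℝ × ℝ => g z.1 z.2) ∧
      ∀ x ∈ Icc (0 : ℝ) 1, ∀ t ∈ Icc 0 T, f x t = g x t := by
  refine ⟨fun x t => f (clamp 1 x) (clamp T t), ?_, fun x hx t ht => ?_⟩
  · exact hf.comp_continuous (f := fun z : ℝ × ℝ => (clamp 1 z.1, clamp T z.2))
      (((continuous_clamp 1).comp continuous_fst).prodMk
        ((continuous_clamp T).comp continuous_snd))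
      fun _ => ⟨clamp_mem zero_le_one _, clamp_mem hT _⟩
  · simp only [clamp_of_mem hx, clamp_of_mem ht]

lemma continuous_integral_of_continuous {X : Type*} [TopologicalSpace X]
    {f : X → ℝ → ℝ} (hf : Continuous f.uncurry) {p q : X → ℝ} (hp : Continuous p)
    (hq : Continuous q) : Continuous fun x => ∫ t in p x..q x, f x t := by
  have h : ∀ x, ∫ t in p x..q x, f x t = (∫ t in (0 : ℝ)..q x, f x t) - ∫ t in (0 : ℝ)..p x, f x t := by
    intro x
    have hx : Continuous (f x) := hf.comp (Continuous.prodMk_right x)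
    rw [intervalIntegral.integral_interval_sub_left (hx.intervalIntegrable _ _)
      (hx.intervalIntegrable _ _)]
  simp only [h]
  exact (intervalIntegral.continuous_parametric_intervalIntegral_of_continuous hf hq).sub
    (intervalIntegral.continuous_parametric_intervalIntegral_of_continuous hf hp)

section Interior

variable {T : ℝ} {Φ : Data} {a : ℝ → ℝ} {u : ℝ → ℝ → ℝ}

lemma IsClassicalSolution.hasDerivAt_x (h : IsClassicalSolution T Φ a u) {x t : ℝ}
    (hx : x ∈ Ioo (0 : ℝ) 1) (ht : t ∈ Icc 0 T) : HasDerivAt (fun y => u y t) (dx u x t) x :=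
  (h.u_C10.diff_x (x, t) ⟨Ioo_subset_Icc_self hx, ht⟩).hasDerivWithinAt.hasDerivAt
    (Icc_mem_nhds hx.1 hx.2)

lemma IsClassicalSolution.hasDerivAt_xx (h : IsClassicalSolution T Φ a u) {x t : ℝ}
    (hx : x ∈ Ioo (0 : ℝ) 1) (ht : t ∈ Ioc 0 T) :
    HasDerivAt (fun y => dx u y t) (dx (dx u) x t) x :=
  (h.u_C21.diff_xx (x, t) ⟨hx, ht⟩).hasDerivWithinAt.hasDerivAt (Icc_mem_nhds hx.1 hx.2)

lemma IsClassicalSolution.hasDerivAt_t (h : IsClassicalSolution T Φ a u) {x t : ℝ}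
    (hx : x ∈ Ioo (0 : ℝ) 1) (ht : t ∈ Ioo 0 T) : HasDerivAt (fun s => u x s) (dt T u x t) t :=
  (h.u_C21.diff_t (x, t) ⟨hx, Ioo_subset_Ioc_self ht⟩).hasDerivWithinAt.hasDerivAt
    (Icc_mem_nhds ht.1 ht.2)

/-- The weak form of the equation on a rectangle inside the domain. -/
lemma IsClassicalSolution.integral_sub_eq (h : IsClassicalSolution T Φ a u)
    (hF : ContinuousOn (fun z : ℝ × ℝ => Φ.F z.1 z.2) (closedQ T))
    {y y₁ y₂ : ℝ → ℝ} (hy : ∀ x, HasDerivAt y (y₁ x) x) (hy₁ : ∀ x, HasDerivAt y₁ (y₂ x) x)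
    (hy₂ : Continuous y₂) {α β s t : ℝ} (hα : 0 < α) (hαβ : α ≤ β) (hβ : β < 1) (hs : 0 < s)
    (hst : s ≤ t) (ht : t ≤ T) :
    ∫ x in α..β, (u x t - u x s) * y x = ∫ τ in s..t, (a τ * ((dx u β τ * y β - u β τ * y₁ β)
      - (dx u α τ * y α - u α τ * y₁ α) + ∫ x in α..β, u x τ * y₂ x)
      + ∫ x in α..β, Φ.F x τ * y x) := by
  have hyc : Continuous y := continuous_iff_continuousAt.mpr fun x => (hy x).continuousAt
  have hsub : Icc α β ×ˢ Icc s t ⊆ domQ T := fun z hz =>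
    ⟨⟨hα.trans_le hz.1.1, hz.1.2.trans_lt hβ⟩, ⟨hs.trans_le hz.2.1, hz.2.2.trans ht⟩⟩
  have hx : ∀ x ∈ Icc α β, x ∈ Ioo (0 : ℝ) 1 := fun x hx =>
    ⟨hα.trans_le hx.1, hx.2.trans_lt hβ⟩
  have htt : ∀ τ ∈ Icc s t, τ ∈ Ioc 0 T := fun τ hτ => ⟨hs.trans_le hτ.1, hτ.2.trans ht⟩
  have slice_t : ∀ {f : ℝ → ℝ → ℝ}, ContinuousOn (fun z : ℝ × ℝ => f z.1 z.2) (domQ T) →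
      ∀ x ∈ Icc α β, ContinuousOn (fun τ => f x τ) (Icc s t) := fun hf x hx =>
    hf.comp (f := fun τ : ℝ => (x, τ)) (by fun_prop) fun τ hτ => hsub ⟨hx, hτ⟩
  have slice_x : ∀ {f : ℝ → ℝ → ℝ}, ContinuousOn (fun z : ℝ × ℝ => f z.1 z.2) (domQ T) →
      ∀ τ ∈ Icc s t, ContinuousOn (fun x => f x τ) (Icc α β) := fun hf τ hτ =>
    hf.comp (f := fun x : ℝ => (x, τ)) (by fun_prop) fun x hx => hsub ⟨hx, hτ⟩
  -- On a rectangle inside `domQ T` all derivatives are continuous: integrate `u_t` in time,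
  -- exchange the integrals, insert the equation and move both `x`-derivatives onto `y`.
  have step1 : ∀ x ∈ Icc α β, (u x t - u x s) * y x = ∫ τ in s..t, dt T u x τ * y x := by
    intro x hx'
    rw [intervalIntegral.integral_mul_const]
    congr 1
    refine (intervalIntegral.integral_eq_sub_of_hasDerivAt_of_le hst
      (slice_t h.u_C21.continuousOn x hx') (fun τ hτ => h.hasDerivAt_t (hx x hx')
        ⟨hs.trans hτ.1, hτ.2.trans_le ht⟩) ?_).symm
    exact ContinuousOn.intervalIntegrable (by
      rw [uIcc_of_le hst]; exact slice_t h.u_C21.continuousOn_dt x hx')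
  have step2 : ∫ x in α..β, (u x t - u x s) * y x
      = ∫ x in α..β, ∫ τ in s..t, dt T u x τ * y x := by
    refine intervalIntegral.integral_congr fun x hx' => ?_
    rw [uIcc_of_le hαβ] at hx'
    exact step1 x hx'
  rw [step2, MeasureTheory.intervalIntegral_intervalIntegral_swap]
  · refine intervalIntegral.integral_congr fun τ hτ => ?_
    rw [uIcc_of_le hst] at hτ
    have hτ' := htt τ hτ
    have hτ'' := Ioc_subset_Icc_self hτ'
    have ibp : ∫ x in α..β, (dx (dx u) x τ * y x - u x τ * y₂ x)
        = (dx u β τ * y β - u β τ * y₁ β) - (dx u α τ * y α - u α τ * y₁ α) := by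
      refine intervalIntegral.integral_eq_sub_of_hasDerivAt
        (f := fun x => dx u x τ * y x - u x τ * y₁ x) (fun x hx' => ?_) ?_
      · rw [uIcc_of_le hαβ] at hx'
        exact (((h.hasDerivAt_xx (hx x hx') hτ').mul (hy x)).sub
          ((h.hasDerivAt_x (hx x hx') hτ'').mul (hy₁ x))).congr_deriv (by ring)
      · apply ContinuousOn.intervalIntegrable
        rw [uIcc_of_le hαβ]
        exact ((slice_x h.u_C21.continuousOn_dxx τ hτ).mul hyc.continuousOn).sub
          ((slice_x h.u_C21.continuousOn τ hτ).mul hy₂.continuousOn)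
    have i1 : IntervalIntegrable (fun x => dx (dx u) x τ * y x) MeasureTheory.volume α β := by
      apply ContinuousOn.intervalIntegrable
      rw [uIcc_of_le hαβ]
      exact (slice_x h.u_C21.continuousOn_dxx τ hτ).mul hyc.continuousOn
    have i2 : IntervalIntegrable (fun x => u x τ * y₂ x) MeasureTheory.volume α β := by
      apply ContinuousOn.intervalIntegrable
      rw [uIcc_of_le hαβ]
      exact (slice_x h.u_C21.continuousOn τ hτ).mul hy₂.continuousOn
    have i3 : IntervalIntegrable (fun x => Φ.F x τ * y x) MeasureTheory.volume α β := by
      apply ContinuousOn.intervalIntegrable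
      rw [uIcc_of_le hαβ]
      exact (hF.comp (f := fun x : ℝ => (x, τ)) (by fun_prop) fun x hx' =>
        ⟨Ioo_subset_Icc_self (hx x hx'), hτ''⟩).mul hyc.continuousOn
    rw [intervalIntegral.integral_sub i1 i2] at ibp
    have e : ∫ x in α..β, dt T u x τ * y x
        = ∫ x in α..β, (a τ * (dx (dx u) x τ * y x) + Φ.F x τ * y x) := by
      refine intervalIntegral.integral_congr fun x hx' => ?_
      rw [uIcc_of_le hαβ] at hx'
      simp only [h.equation x (hx x hx') τ hτ']
      ring
    simp only [e]
    rw [intervalIntegral.integral_add (i1.const_mul _) i3, intervalIntegral.integral_const_mul]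
    congr 2
    linarith
  · refine MeasureTheory.IntegrableOn.mono_set (t := Icc α β ×ˢ Icc s t) ?_ ?_
    · refine ContinuousOn.integrableOn_compact (isCompact_Icc.prod isCompact_Icc) ?_
      exact (h.u_C21.continuousOn_dt.mono hsub).mul (hyc.comp continuous_fst).continuousOn
    · rw [uIoc_of_le hαβ, uIoc_of_le hst]
      exact prod_mono Ioc_subset_Icc_self Ioc_subset_Icc_self

/-- Moments of a solution against a test function are differentiable up to `t = 0`. -/
theorem IsClassicalSolution.hasDerivWithinAt_moment (hT : 0 < T)
    (h : IsClassicalSolution T Φ a u)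
    (hF : ContinuousOn (fun z : ℝ × ℝ => Φ.F z.1 z.2) (closedQ T))
    {y y₁ y₂ : ℝ → ℝ} (hy : ∀ x, HasDerivAt y (y₁ x) x) (hy₁ : ∀ x, HasDerivAt y₁ (y₂ x) x)
    (hy₂ : Continuous y₂) {t : ℝ} (ht : t ∈ Icc 0 T) :
    HasDerivWithinAt (fun t => ∫ x in (0 : ℝ)..1, u x t * y x)
      (a t * (-(dx u 0 t * y 0) - u 0 t * (y₁ 1 - y₁ 0) + ∫ x in (0 : ℝ)..1, u x t * y₂ x)
        + ∫ x in (0 : ℝ)..1, Φ.F x t * y x) (Icc 0 T) t := by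
  have hyc : Continuous y := continuous_iff_continuousAt.mpr fun x => (hy x).continuousAt
  have hy₁c : Continuous y₁ := continuous_iff_continuousAt.mpr fun x => (hy₁ x).continuousAt
  obtain ⟨U, hU, hUu⟩ := exists_continuous_extension hT.le h.u_C10.continuousOn
  obtain ⟨V, hV, hVu⟩ := exists_continuous_extension hT.le h.u_C10.continuousOn_dx
  obtain ⟨G, hG, hGF⟩ := exists_continuous_extension hT.le hF
  obtain ⟨A, hA, hAa⟩ : ∃ A : ℝ → ℝ, Continuous A ∧ ∀ t ∈ Icc 0 T, a t = A t :=
    ⟨_, h.a_continuousOn.comp_continuous (continuous_clamp T) fun t => clamp_mem hT.le t,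
      fun t ht => by simp only [Function.comp, clamp_of_mem ht]⟩
  -- The weak form on `[ε, 1 - ε]` contains only `u`, `u_x`, `a` and `F`, all continuous up to the
  -- boundary. With their continuous extensions `J` is jointly continuous, although `u_xx` and `u_t`
  -- may be singular at the boundary.
  set J : ℝ → ℝ → ℝ := fun ε τ => A τ * ((V (1 - ε) τ * y (1 - ε) - U (1 - ε) τ * y₁ (1 - ε))
      - (V ε τ * y ε - U ε τ * y₁ ε) + ∫ x in ε..(1 - ε), U x τ * y₂ x)
      + ∫ x in ε..(1 - ε), G x τ * y x with hJ
  have comp2 : ∀ {X : Type} [TopologicalSpace X] {W : ℝ → ℝ → ℝ},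
      (Continuous fun z : ℝ × ℝ => W z.1 z.2) → ∀ {p q : X → ℝ}, Continuous p → Continuous q →
      Continuous fun z => W (p z) (q z) :=
    fun hW _ _ hp hq => hW.comp (hp.prodMk hq)
  have hJc : Continuous J.uncurry := by
    have i1 : Continuous fun z : ℝ × ℝ => ∫ x in z.1..(1 - z.1), U x z.2 * y₂ x :=
      continuous_integral_of_continuous (f := fun (z : ℝ × ℝ) x => U x z.2 * y₂ x)
        ((comp2 hU (by fun_prop) (by fun_prop)).mul (by fun_prop)) (by fun_prop) (by fun_prop)
    have i2 : Continuous fun z : ℝ × ℝ => ∫ x in z.1..(1 - z.1), G x z.2 * y x :=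
      continuous_integral_of_continuous (f := fun (z : ℝ × ℝ) x => G x z.2 * y x)
        ((comp2 hG (by fun_prop) (by fun_prop)).mul (by fun_prop)) (by fun_prop) (by fun_prop)
    have j1 : Continuous fun z : ℝ × ℝ => V (1 - z.1) z.2 := comp2 hV (by fun_prop) (by fun_prop)
    have j2 : Continuous fun z : ℝ × ℝ => U (1 - z.1) z.2 := comp2 hU (by fun_prop) (by fun_prop)
    exact ((hA.comp continuous_snd).mul ((((j1.mul (by fun_prop)).sub (j2.mul (by fun_prop))).sub
      ((hV.mul (by fun_prop)).sub (hU.mul (by fun_prop)))).add i1)).add i2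
  have hJ0 : Continuous (J 0) := hJc.comp (Continuous.prodMk_right 0)
  have inner : ∀ t ∈ Ioc 0 T, ∀ ε ∈ Ioo (0 : ℝ) (1 / 2),
      ∫ x in ε..(1 - ε), (U x t - U x (ε * t)) * y x = ∫ τ in (ε * t)..t, J ε τ := by
    intro t ht ε hε
    have hεt : 0 < ε * t := mul_pos hε.1 ht.1
    have hle : ε * t ≤ t := by nlinarith [ht.1, hε.2]
    have hεε : ε ≤ 1 - ε := by linarith [hε.2]
    have hi := h.integral_sub_eq hF hy hy₁ hy₂ hε.1 hεε (by linarith [hε.1]) hεt hle ht.2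
    have hxm : ∀ x ∈ uIcc ε (1 - ε), x ∈ Icc (0 : ℝ) 1 := fun x hx => by
      rw [uIcc_of_le hεε] at hx; exact ⟨by linarith [hx.1, hε.1], by linarith [hx.2, hε.1]⟩
    have hτm : ∀ τ ∈ uIcc (ε * t) t, τ ∈ Icc 0 T := fun τ hτ => by
      rw [uIcc_of_le hle] at hτ; exact ⟨hεt.le.trans hτ.1, hτ.2.trans ht.2⟩
    have hεm := hxm ε left_mem_uIcc
    have hεm' := hxm (1 - ε) right_mem_uIcc
    have l : ∫ x in ε..(1 - ε), (U x t - U x (ε * t)) * y x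
        = ∫ x in ε..(1 - ε), (u x t - u x (ε * t)) * y x :=
      intervalIntegral.integral_congr fun x hx => by
        simp only [hUu x (hxm x hx) t (hτm _ right_mem_uIcc),
          hUu x (hxm x hx) _ (hτm _ left_mem_uIcc)]
    rw [l, hi]
    refine intervalIntegral.integral_congr fun τ hτ => ?_
    have hτ' := hτm τ hτ
    simp only [hJ, hAa τ hτ', hVu _ hεm τ hτ', hVu _ hεm' τ hτ', hUu _ hεm τ hτ', hUu _ hεm' τ hτ']
    congr 1
    · congr 2
      exact intervalIntegral.integral_congr fun x hx => by simp only [hUu x (hxm x hx) τ hτ']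
    · exact intervalIntegral.integral_congr fun x hx => by simp only [hGF x (hxm x hx) τ hτ']
  have ident : ∀ t ∈ Icc 0 T, ∫ x in (0 : ℝ)..1, (U x t - U x 0) * y x = ∫ τ in (0 : ℝ)..t, J 0 τ := by
    intro t ht
    rcases ht.1.eq_or_lt with rfl | ht0
    · simp
    have c1 : Continuous fun ε : ℝ => ∫ x in ε..(1 - ε), (U x t - U x (ε * t)) * y x :=
      continuous_integral_of_continuous (f := fun ε x => (U x t - U x (ε * t)) * y x)
        (((comp2 hU (by fun_prop) (by fun_prop)).sub (comp2 hU (by fun_prop) (by fun_prop))).mul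
          (by fun_prop)) (by fun_prop) (by fun_prop)
    have c2 : Continuous fun ε : ℝ => ∫ τ in (ε * t)..t, J ε τ :=
      continuous_integral_of_continuous hJc (by fun_prop) (by fun_prop)
    -- The identity holds for `0 < ε < 1/2` and both sides are continuous in `ε`. Since the initial
    -- time is `ε * t`, this one limit reaches the lateral boundary and `t = 0` together.
    have hcl : (0 : ℝ) ∈ closure (Ioo (0 : ℝ) (1 / 2)) := by
      rw [closure_Ioo (by norm_num)]; simp
    have := (isClosed_eq c1 c2).closure_subset_iff.mpr (inner t ⟨ht0, ht.2⟩) hcl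
    simpa using this
  have hprim : HasDerivAt (fun t => (∫ x in (0 : ℝ)..1, U x 0 * y x) + ∫ τ in (0 : ℝ)..t, J 0 τ)
      (J 0 t) t :=
    (hJ0.integral_hasStrictDerivAt 0 t).hasDerivAt.const_add _
  have h01 : ∀ x ∈ uIcc (0 : ℝ) 1, x ∈ Icc (0 : ℝ) 1 := fun x hx => by
    rwa [uIcc_of_le zero_le_one] at hx
  have heq : ∀ t ∈ Icc 0 T, ∫ x in (0 : ℝ)..1, u x t * y x
      = (∫ x in (0 : ℝ)..1, U x 0 * y x) + ∫ τ in (0 : ℝ)..t, J 0 τ := by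
    intro t ht
    have hUt : ∀ t, Continuous fun x => U x t * y x := fun t =>
      (comp2 hU (by fun_prop) (by fun_prop)).mul hyc
    rw [← ident t ht, ← intervalIntegral.integral_add ((hUt 0).intervalIntegrable _ _) (by
      simp only [sub_mul]
      exact ((hUt t).intervalIntegrable _ _).sub ((hUt 0).intervalIntegrable _ _))]
    refine intervalIntegral.integral_congr fun x hx => ?_
    simp only [hUu x (h01 x hx) t ht]
    ring
  refine (hprim.hasDerivWithinAt.congr heq (heq t ht)).congr_deriv ?_
  have m0 : (0 : ℝ) ∈ Icc (0 : ℝ) 1 := by simp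
  have m1 : (1 : ℝ) ∈ Icc (0 : ℝ) 1 := by simp
  have e1 : ∫ x in (0 : ℝ)..1, u x t * y₂ x = ∫ x in (0 : ℝ)..1, U x t * y₂ x :=
    intervalIntegral.integral_congr fun x hx => by simp only [hUu x (h01 x hx) t ht]
  have e2 : ∫ x in (0 : ℝ)..1, Φ.F x t * y x = ∫ x in (0 : ℝ)..1, G x t * y x :=
    intervalIntegral.integral_congr fun x hx => by simp only [hGF x (h01 x hx) t ht]
  have b1 := h.boundary_periodic t ht
  have b2 := h.boundary_deriv t ht
  rw [hUu 0 m0 t ht, hUu 1 m1 t ht] at b1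
  rw [hVu 1 m1 t ht] at b2
  rw [e1, e2, hAa t ht, hVu 0 m0 t ht, hUu 0 m0 t ht]
  simp only [hJ, sub_zero, b2, ← b1]
  ring

end Interior

/-! ### Comparison for linear scalar equations with damping. -/

/-- Comparison principle for `d' = -p d + g` with `p ≥ 0`. -/
lemma le_of_hasDerivWithinAt {T : ℝ} {d p g B B' : ℝ → ℝ}
    (hd : ∀ t ∈ Icc 0 T, HasDerivWithinAt d (-(p t * d t) + g t) (Icc 0 T) t)
    (hp : ∀ t ∈ Icc 0 T, 0 ≤ p t)
    (hB : ∀ t ∈ Icc 0 T, HasDerivWithinAt B (B' t) (Icc 0 T) t)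
    (hB0 : ∀ t ∈ Icc 0 T, 0 ≤ B t) (hg : ∀ t ∈ Icc 0 T, g t ≤ B' t) (h0 : d 0 ≤ B 0) :
    ∀ t ∈ Icc 0 T, d t ≤ B t := by
  have right : ∀ {f : ℝ → ℝ} {f' t : ℝ}, t ∈ Ico 0 T → HasDerivWithinAt f f' (Icc 0 T) t →
      HasDerivWithinAt f f' (Ici t) t := fun ht hf =>
    (hf.mono (Icc_subset_Icc_left ht.1)).mono_of_mem_nhdsWithin (Icc_mem_nhdsGE ht.2)
  -- The term `ε * (1 + t)` makes the derivative inequality strict. It is only needed at a contact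
  -- point, where `d` equals a nonnegative barrier, so `-(p t * d t) ≤ 0` can be dropped.
  have key : ∀ ε > 0, ∀ t ∈ Icc 0 T, d t ≤ B t + ε * (1 + t) := by
    intro ε hε
    have hBε : ∀ t ∈ Icc 0 T,
        HasDerivWithinAt (fun t => B t + ε * (1 + t)) (B' t + ε) (Icc 0 T) t := fun t ht =>
      ((hB t ht).add ((((hasDerivAt_id' t).const_add 1).const_mul ε).hasDerivWithinAt)).congr_deriv
        (by ring)
    refine image_le_of_deriv_right_lt_deriv_boundary' (f' := fun t => -(p t * d t) + g t)
      (B' := fun t => B' t + ε) (fun t ht => (hd t ht).continuousWithinAt)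
      (fun t ht => right ht (hd t (Ico_subset_Icc_self ht))) (by linarith)
      (fun t ht => (hBε t ht).continuousWithinAt)
      (fun t ht => right ht (hBε t (Ico_subset_Icc_self ht))) fun t ht heq => ?_
    have ht' := Ico_subset_Icc_self ht
    have hpos : 0 ≤ d t := by
      rw [heq]
      have := hB0 t ht'
      have := mul_nonneg hε.le (by linarith [ht.1] : 0 ≤ 1 + t)
      linarith
    have := mul_nonneg (hp t ht') hpos
    have := hg t ht'
    linarith
  intro t ht
  have hlim : Filter.Tendsto (fun ε : ℝ => B t + ε * (1 + t)) (nhdsWithin 0 (Ioi 0)) (nhds (B t)) := by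
    have : Continuous fun ε : ℝ => B t + ε * (1 + t) := by fun_prop
    simpa using (this.tendsto 0).mono_left nhdsWithin_le_nhds
  exact ge_of_tendsto hlim (Filter.eventually_of_mem self_mem_nhdsWithin fun ε hε => key ε hε t ht)

/-- The bound does not involve `p`, which is what makes it uniform in the damping `a * freq k ^ 2`
for all `k`. -/
lemma abs_le_of_hasDerivWithinAt {T : ℝ} {d p g : ℝ → ℝ} {c G : ℝ}
    (hd : ∀ t ∈ Icc 0 T, HasDerivWithinAt d (-(p t * d t) + g t) (Icc 0 T) t)
    (hp : ∀ t ∈ Icc 0 T, 0 ≤ p t) (hg : ∀ t ∈ Icc 0 T, |g t| ≤ G) (h0 : |d 0| ≤ c) :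
    ∀ t ∈ Icc 0 T, |d t| ≤ c + T * G := by
  intro t ht
  have hG : 0 ≤ G := (abs_nonneg _).trans (hg t ht)
  have hc : 0 ≤ c := (abs_nonneg _).trans h0
  have hB : ∀ t ∈ Icc 0 T, HasDerivWithinAt (fun t => c + t * G) G (Icc 0 T) t := fun t _ =>
    (((hasDerivAt_id' t).mul_const G).const_add c).hasDerivWithinAt.congr_deriv (by ring)
  have hB0 : ∀ t ∈ Icc 0 T, 0 ≤ c + t * G := fun t ht => add_nonneg hc (mul_nonneg ht.1 hG)
  have h1 := le_of_hasDerivWithinAt hd hp hB hB0 (fun t ht => (le_abs_self _).trans (hg t ht))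
    (by simpa using (le_abs_self _).trans h0) t ht
  have h2 := le_of_hasDerivWithinAt (d := fun t => -d t) (g := fun t => -g t)
    (fun t ht => (hd t ht).neg.congr_deriv (by ring)) hp hB hB0
    (fun t ht => (neg_le_abs _).trans (hg t ht)) (by simpa using (neg_le_abs _).trans h0) t ht
  have h3 : t * G ≤ T * G := mul_le_mul_of_nonneg_right ht.2 hG
  rw [abs_le]
  constructor <;> linarith

/-! ### Equations in time for the coefficients, and sign of the sine coefficients. -/

lemma continuous_Y (n : ℕ) : Continuous (Y n) := by
  unfold Y
  split_ifs <;> fun_prop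

lemma intervalIntegrable_mul_Y {f : ℝ → ℝ} (hf : ContinuousOn f (Icc 0 1)) (n : ℕ) :
    IntervalIntegrable (fun x => f x * Y n x) MeasureTheory.volume 0 1 :=
  intervalIntegrable_mul hf (continuous_Y n)

lemma coeffY_sub {f g : ℝ → ℝ} (hf : ContinuousOn f (Icc 0 1)) (hg : ContinuousOn g (Icc 0 1))
    (n : ℕ) : coeffY (fun x => f x - g x) n = coeffY f n - coeffY g n := by
  simp only [coeffY, sub_mul]
  exact intervalIntegral.integral_sub (intervalIntegrable_mul_Y hf n)
    (intervalIntegrable_mul_Y hg n)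

lemma continuousOn_slice {T : ℝ} {f : ℝ → ℝ → ℝ}
    (hf : ContinuousOn (fun z : ℝ × ℝ => f z.1 z.2) (closedQ T)) {t : ℝ} (ht : t ∈ Icc 0 T) :
    ContinuousOn (fun x => f x t) (Icc 0 1) :=
  hf.comp (f := fun x : ℝ => (x, t)) (by fun_prop) fun _ hx => ⟨hx, ht⟩

lemma continuousOn_coeffY {T : ℝ} (hT : 0 ≤ T) {f : ℝ → ℝ → ℝ}
    (hf : ContinuousOn (fun z : ℝ × ℝ => f z.1 z.2) (closedQ T)) (n : ℕ) :
    ContinuousOn (fun t => coeffY (fun x => f x t) n) (Icc 0 T) := by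
  obtain ⟨g, hg, hfg⟩ := exists_continuous_extension hT hf
  have hY := continuous_Y n
  have hc : Continuous fun t => ∫ x in (0 : ℝ)..1, g x t * Y n x :=
    intervalIntegral.continuous_parametric_intervalIntegral_of_continuous'
      (f := fun t x => g x t * Y n x)
      ((hg.comp (continuous_snd.prodMk continuous_fst)).mul (hY.comp continuous_snd)) 0 1
  refine hc.continuousOn.congr fun t ht => ?_
  refine intervalIntegral.integral_congr fun x hx => ?_
  rw [uIcc_of_le zero_le_one] at hx
  simp only [hfg x hx t ht]

section Solution

variable {T : ℝ} {Φ : Data} {a : ℝ → ℝ} {u : ℝ → ℝ → ℝ}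

lemma IsClassicalSolution.continuousOn_slice (h : IsClassicalSolution T Φ a u) {t : ℝ}
    (ht : t ∈ Icc 0 T) : ContinuousOn (fun x => u x t) (Icc 0 1) :=
  HeatInverse.continuousOn_slice h.u_C10.continuousOn ht

/-- The sine satisfies the adjoint boundary conditions: it vanishes at `0`, which removes the
unknown `u_x(0,t)`, and its derivative agrees at the two ends, which removes `u(0,t)`. -/
lemma IsClassicalSolution.hasDerivWithinAt_sin (hT : 0 < T) (h : IsClassicalSolution T Φ a u)
    (hΦ : Φ.Admissible T) (k : ℕ) {t : ℝ} (ht : t ∈ Icc 0 T) :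
    HasDerivWithinAt (fun t => coeffY (fun x => u x t) (2 * (k + 1)))
      (-(a t * freq k ^ 2 * coeffY (fun x => u x t) (2 * (k + 1)))
        + coeffY (fun x => Φ.F x t) (2 * (k + 1))) (Icc 0 T) t := by
  simp only [coeffY_even]
  refine (h.hasDerivWithinAt_moment hT hΦ.a3.continuousOn
    (y := fun x => Real.sin (freq k * x)) (y₁ := fun x => freq k * Real.cos (freq k * x))
    (y₂ := fun x => -freq k ^ 2 * Real.sin (freq k * x))
    (hasDerivAt_sin_mul _) (fun x => ((hasDerivAt_cos_mul _ x).const_mul _).congr_deriv (by ring))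
    (by fun_prop) ht).congr_deriv ?_
  have e : ∫ x in (0 : ℝ)..1, u x t * (-freq k ^ 2 * Real.sin (freq k * x))
      = -freq k ^ 2 * sinCoeff (fun x => u x t) k := by
    simp only [sinCoeff, mul_left_comm (u _ _), intervalIntegral.integral_const_mul]
  rw [e]
  simp [sinCoeff]
  ring

/-- The function `x cos(ωx)` satisfies the same adjoint conditions but is only an associated
function: its second derivative has the extra term `-2ω sin(ωx)`, which couples the equation to the
sine coefficient. -/
lemma IsClassicalSolution.hasDerivWithinAt_cos (hT : 0 < T) (h : IsClassicalSolution T Φ a u)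
    (hΦ : Φ.Admissible T) (k : ℕ) {t : ℝ} (ht : t ∈ Icc 0 T) :
    HasDerivWithinAt (fun t => coeffY (fun x => u x t) (2 * k + 1))
      (-(a t * freq k ^ 2 * coeffY (fun x => u x t) (2 * k + 1))
        + (-(2 * freq k * (a t * coeffY (fun x => u x t) (2 * (k + 1))))
          + coeffY (fun x => Φ.F x t) (2 * k + 1))) (Icc 0 T) t := by
  simp only [coeffY_even, coeffY_odd, cosCoeff, sinCoeff]
  have hm := h.hasDerivWithinAt_moment hT hΦ.a3.continuousOn
    (y := fun x => x * Real.cos (freq k * x))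
    (y₁ := fun x => Real.cos (freq k * x) - freq k * (x * Real.sin (freq k * x)))
    (y₂ := fun x => -(2 * freq k) * Real.sin (freq k * x)
      + -freq k ^ 2 * (x * Real.cos (freq k * x)))
    (fun x => ((hasDerivAt_id' x).mul (hasDerivAt_cos_mul _ x)).congr_deriv (by ring))
    (fun x => ((hasDerivAt_cos_mul _ x).sub (((hasDerivAt_id' x).mul
      (hasDerivAt_sin_mul _ x)).const_mul _)).congr_deriv (by ring))
    (by fun_prop) ht
  have e : ∫ x in (0 : ℝ)..1, u x t * (-(2 * freq k) * Real.sin (freq k * x)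
      + -freq k ^ 2 * (x * Real.cos (freq k * x)))
      = -(2 * freq k) * (∫ x in (0 : ℝ)..1, u x t * Real.sin (freq k * x))
        + -freq k ^ 2 * ∫ x in (0 : ℝ)..1, u x t * (x * Real.cos (freq k * x)) := by
    have hu := h.continuousOn_slice ht
    rw [← intervalIntegral.integral_const_mul, ← intervalIntegral.integral_const_mul,
      ← intervalIntegral.integral_add
        ((intervalIntegrable_mul hu (continuous_sin_freq k)).const_mul _)
        ((intervalIntegrable_mul hu (by fun_prop)).const_mul _)]
    congr 1; funext x; ring
  have e' : ∀ f : ℝ → ℝ, ∫ x in (0 : ℝ)..1, x * f x * Real.cos (freq k * x)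
      = ∫ x in (0 : ℝ)..1, f x * (x * Real.cos (freq k * x)) := fun f => by
    congr 1; funext x; ring
  simp only [e' (fun x => u x _), e' (fun x => Φ.F x _)]
  refine hm.congr_deriv ?_
  rw [e]
  simp
  ring

lemma IsClassicalSolution.hasDerivWithinAt_zero (hT : 0 < T) (h : IsClassicalSolution T Φ a u)
    (hΦ : Φ.Admissible T) {t : ℝ} (ht : t ∈ Icc 0 T) :
    HasDerivWithinAt (fun t => coeffY (fun x => u x t) 0) (coeffY (fun x => Φ.F x t) 0)
      (Icc 0 T) t := by
  simp only [coeffY_zero]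
  refine (h.hasDerivWithinAt_moment hT hΦ.a3.continuousOn (y := fun x => x) (y₁ := fun _ => 1)
    (y₂ := fun _ => 0) hasDerivAt_id' (fun x => hasDerivAt_const x 1) (by fun_prop) ht).congr_deriv ?_
  simp

/-- The identity `E' = -a u_x(0,·) + ∫ F dx`. -/
lemma IsClassicalSolution.a_mul_dx_zero (hT : 0 < T) (h : IsClassicalSolution T Φ a u)
    (hΦ : Φ.Admissible T) {t : ℝ} (ht : t ∈ Icc 0 T) :
    a t * dx u 0 t = -derivWithin Φ.E (Icc 0 T) t + ∫ x in (0 : ℝ)..1, Φ.F x t := by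
  have hm := h.hasDerivWithinAt_moment hT hΦ.a3.continuousOn (y := fun _ => 1) (y₁ := fun _ => 0)
    (y₂ := fun _ => 0) (fun x => hasDerivAt_const x 1) (fun x => hasDerivAt_const x 0)
    (by fun_prop) ht
  simp only [mul_one, sub_self, mul_zero, intervalIntegral.integral_zero, sub_zero, add_zero] at hm
  have hE := (hm.congr (fun s hs => (h.overdetermination s hs).symm)
    (h.overdetermination t ht).symm).derivWithin (uniqueDiffOn_Icc hT t ht)
  rw [hE]; ring

lemma IsClassicalSolution.coeffY_initial (h : IsClassicalSolution T Φ a u) (n : ℕ) :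
    coeffY (fun x => u x 0) n = coeffY Φ.φ n :=
  intervalIntegral.integral_congr fun x hx => by
    rw [uIcc_of_le zero_le_one] at hx
    simp only [h.initial x hx]

/-- Comparison of `-u_{2k}` with the barrier `0`; this is where the signs of `φ_{2k}` and `F_{2k}`
enter the lower bound for `u_x(0,·)`. -/
lemma IsClassicalSolution.coeffY_even_nonneg (hT : 0 < T) (h : IsClassicalSolution T Φ a u)
    (hΦ : Φ.Admissible T) (k : ℕ) {t : ℝ} (ht : t ∈ Icc 0 T) :
    0 ≤ coeffY (fun x => u x t) (2 * (k + 1)) := by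
  have := le_of_hasDerivWithinAt (d := fun t => -coeffY (fun x => u x t) (2 * (k + 1)))
    (p := fun t => a t * freq k ^ 2) (g := fun t => -coeffY (fun x => Φ.F x t) (2 * (k + 1)))
    (B := fun _ => 0) (B' := fun _ => 0)
    (fun t ht => (h.hasDerivWithinAt_sin hT hΦ k ht).neg.congr_deriv (by ring))
    (fun t ht => mul_nonneg (h.a_pos t ht).le (sq_nonneg _))
    (fun t _ => hasDerivWithinAt_const _ _ _) (fun _ _ => le_rfl)
    (fun t ht => by simpa using hΦ.a3.coeff_nonneg (k + 1) t ht)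
    (by
      rw [h.coeffY_initial]
      simpa using hΦ.a2.coeff_nonneg (k + 1) (by omega)) t ht
  linarith

/-- Bound for the coefficient `u_{2k}` of a solution, uniform in time. -/
noncomputable def Data.envelope (T : ℝ) (Φ : Data) (k : ℕ) : ℝ :=
  coeffY Φ.φ (2 * (k + 1)) + ∫ τ in (0 : ℝ)..T, coeffY (fun x => Φ.F x τ) (2 * (k + 1))

lemma integral_le_integral_of_nonneg {T : ℝ} {f : ℝ → ℝ} (hf : ContinuousOn f (Icc 0 T))
    (h0 : ∀ t ∈ Icc 0 T, 0 ≤ f t) {t : ℝ} (ht : t ∈ Icc 0 T) :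
    ∫ τ in (0 : ℝ)..t, f τ ≤ ∫ τ in (0 : ℝ)..T, f τ := by
  have hi : IntervalIntegrable f MeasureTheory.volume 0 T := by
    apply ContinuousOn.intervalIntegrable; rwa [uIcc_of_le (ht.1.trans ht.2)]
  refine intervalIntegral.integral_mono_interval le_rfl ht.1 ht.2 ?_ hi
  filter_upwards [MeasureTheory.ae_restrict_mem measurableSet_Ioc] with τ hτ
  exact h0 τ (Ioc_subset_Icc_self hτ)

lemma hasDerivWithinAt_integral {T : ℝ} (hT : 0 ≤ T) {f : ℝ → ℝ} (hf : ContinuousOn f (Icc 0 T))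
    {t : ℝ} (ht : t ∈ Icc 0 T) :
    HasDerivWithinAt (fun t => ∫ τ in (0 : ℝ)..t, f τ) (f t) (Icc 0 T) t := by
  have hc : Continuous fun t => f (clamp T t) :=
    hf.comp_continuous (continuous_clamp T) fun t => clamp_mem hT t
  have := (hc.integral_hasStrictDerivAt 0 t).hasDerivAt.hasDerivWithinAt (s := Icc 0 T)
  rw [clamp_of_mem ht] at this
  have e : ∀ s ∈ Icc 0 T, ∫ τ in (0 : ℝ)..s, f τ = ∫ τ in (0 : ℝ)..s, f (clamp T τ) :=
    fun s hs => intervalIntegral.integral_congr fun τ hτ => by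
      rw [uIcc_of_le hs.1] at hτ
      simp only [clamp_of_mem (⟨hτ.1, hτ.2.trans hs.2⟩ : τ ∈ Icc 0 T)]
  exact this.congr e (e t ht)

/-- Without damping the coefficient would be the accumulated data up to time `t`, which is a barrier
and increases in `t` because `F_{2k} ≥ 0`. -/
lemma IsClassicalSolution.coeffY_even_le_envelope (hT : 0 < T) (h : IsClassicalSolution T Φ a u)
    (hΦ : Φ.Admissible T) (k : ℕ) {t : ℝ} (ht : t ∈ Icc 0 T) :
    coeffY (fun x => u x t) (2 * (k + 1)) ≤ Φ.envelope T k := by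
  have hFc := continuousOn_coeffY hT.le hΦ.a3.continuousOn (2 * (k + 1))
  have hF0 : ∀ t ∈ Icc 0 T, 0 ≤ coeffY (fun x => Φ.F x t) (2 * (k + 1)) :=
    hΦ.a3.coeff_nonneg (k + 1)
  have hφ0 : 0 ≤ coeffY Φ.φ (2 * (k + 1)) := hΦ.a2.coeff_nonneg (k + 1) (by omega)
  have := le_of_hasDerivWithinAt (d := fun t => coeffY (fun x => u x t) (2 * (k + 1)))
    (p := fun t => a t * freq k ^ 2) (g := fun t => coeffY (fun x => Φ.F x t) (2 * (k + 1)))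
    (B := fun t => coeffY Φ.φ (2 * (k + 1))
      + ∫ τ in (0 : ℝ)..t, coeffY (fun x => Φ.F x τ) (2 * (k + 1)))
    (fun t ht => h.hasDerivWithinAt_sin hT hΦ k ht)
    (fun t ht => mul_nonneg (h.a_pos t ht).le (sq_nonneg _))
    (fun t ht => (hasDerivWithinAt_integral hT.le hFc ht).const_add _)
    (fun t ht => add_nonneg hφ0 (intervalIntegral.integral_nonneg ht.1
      fun τ hτ => hF0 τ ⟨hτ.1, hτ.2.trans ht.2⟩))
    (fun _ _ => le_rfl) (by rw [h.coeffY_initial]; simp) t ht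
  exact this.trans (add_le_add_right (integral_le_integral_of_nonneg hFc hF0 ht) _)

end Solution

/-! ### Lower bound for `u_x(0,·)` and upper bounds for `a` and the coefficients. -/

/-- Pointwise bounds for the data. -/
structure Data.BoundedBy (T : ℝ) (Φ : Data) (K₁ K₂ K₃ : ℝ) : Prop where
  φ_le : ∀ j ≤ 4, ∀ x ∈ Icc (0 : ℝ) 1, |iteratedDerivWithin j Φ.φ (Icc 0 1) x| ≤ K₁
  F_le : ∀ t ∈ Icc 0 T, ∀ j ≤ 4, ∀ x ∈ Icc (0 : ℝ) 1,
    |iteratedDerivWithin j (fun x => Φ.F x t) (Icc 0 1) x| ≤ K₂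
  E_le : ∀ t ∈ Icc 0 T, |derivWithin Φ.E (Icc 0 T) t| ≤ K₃

lemma Data.Admissible.compatible_φ {T : ℝ} {Φ : Data} (h : Φ.Admissible T) : Compatible Φ.φ :=
  ⟨h.a2.contDiffOn, h.a2.periodic, h.a2.deriv_one, h.a2.deriv2_periodic⟩

lemma Data.Admissible.compatible_F {T : ℝ} {Φ : Data} (h : Φ.Admissible T) {t : ℝ}
    (ht : t ∈ Icc 0 T) : Compatible fun x => Φ.F x t :=
  ⟨h.a3.contDiffOn t ht, h.a3.periodic t ht, h.a3.deriv_one t ht, h.a3.deriv2_periodic t ht⟩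

section Bounds

variable {T : ℝ} {Φ : Data} {K₁ K₂ K₃ : ℝ}

lemma Data.BoundedBy.K₁_nonneg (hK : Φ.BoundedBy T K₁ K₂ K₃) : 0 ≤ K₁ :=
  (abs_nonneg _).trans (hK.φ_le 0 (by norm_num) 0 (by simp))

lemma Data.BoundedBy.K₂_nonneg (hT : 0 < T) (hK : Φ.BoundedBy T K₁ K₂ K₃) : 0 ≤ K₂ :=
  (abs_nonneg _).trans (hK.F_le 0 ⟨le_rfl, hT.le⟩ 0 (by norm_num) 0 (by simp))

lemma Data.BoundedBy.abs_F_le (hK : Φ.BoundedBy T K₁ K₂ K₃) {t : ℝ} (ht : t ∈ Icc 0 T) :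
    ∀ x ∈ Icc (0 : ℝ) 1, |Φ.F x t| ≤ K₂ := by
  simpa using hK.F_le t ht 0 (by norm_num)

lemma Data.BoundedBy.abs_φ_le (hK : Φ.BoundedBy T K₁ K₂ K₃) :
    ∀ x ∈ Icc (0 : ℝ) 1, |Φ.φ x| ≤ K₁ := by
  simpa using hK.φ_le 0 (by norm_num)

lemma Data.envelope_nonneg (hT : 0 < T) (hΦ : Φ.Admissible T) (k : ℕ) : 0 ≤ Φ.envelope T k :=
  add_nonneg (hΦ.a2.coeff_nonneg (k + 1) (by omega))
    (intervalIntegral.integral_nonneg hT.le fun τ hτ => hΦ.a3.coeff_nonneg (k + 1) τ hτ)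

/-- The finite sum is taken under the time integral, where the Bessel-type bound applies to `F(·,τ)`
for each `τ`. The weight `freq k ^ 3` is exactly what the stability estimate of `u_x(0,·)` consumes.
-/
lemma Data.sum_freq_pow_mul_envelope_le (hT : 0 < T) (hT1 : T ≤ 1) (hΦ : Φ.Admissible T)
    (hK : Φ.BoundedBy T K₁ K₂ K₃) (N : ℕ) :
    ∑ k ∈ Finset.range N, freq k ^ 3 * Φ.envelope T k ≤ K₁ + K₂ := by
  have hFc : ∀ n, ContinuousOn (fun t => coeffY (fun x => Φ.F x t) n) (Icc 0 T) :=
    continuousOn_coeffY hT.le hΦ.a3.continuousOn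
  have hi : ∀ k, IntervalIntegrable (fun τ => freq k ^ 3 * coeffY (fun x => Φ.F x τ) (2 * (k + 1)))
      MeasureTheory.volume 0 T := fun k => by
    apply ContinuousOn.intervalIntegrable
    rw [uIcc_of_le hT.le]
    exact continuousOn_const.mul (hFc _)
  simp only [Data.envelope, mul_add (freq _ ^ 3), Finset.sum_add_distrib]
  refine add_le_add ?_ ?_
  · refine le_trans (Finset.sum_le_sum fun k _ => ?_)
      (hΦ.compatible_φ.sum_freq_pow_mul_abs_sinCoeff_le (hK.φ_le 4 le_rfl) N)
    rw [coeffY_even]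
    exact mul_le_mul_of_nonneg_left (le_abs_self _) (pow_nonneg (freq_pos k).le 3)
  · simp only [← intervalIntegral.integral_const_mul]
    rw [← intervalIntegral.integral_finsetSum fun k _ => hi k]
    have hb : ∀ τ ∈ Icc 0 T,
        ∑ k ∈ Finset.range N, freq k ^ 3 * coeffY (fun x => Φ.F x τ) (2 * (k + 1)) ≤ K₂ := by
      intro τ hτ
      refine le_trans (Finset.sum_le_sum fun k _ => ?_)
        ((hΦ.compatible_F hτ).sum_freq_pow_mul_abs_sinCoeff_le (hK.F_le τ hτ 4 le_rfl) N)
      rw [coeffY_even]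
      exact mul_le_mul_of_nonneg_left (le_abs_self _) (pow_nonneg (freq_pos k).le 3)
    calc _ ≤ ∫ _ in (0 : ℝ)..T, K₂ :=
          intervalIntegral.integral_mono_on hT.le (by
            apply ContinuousOn.intervalIntegrable
            rw [uIcc_of_le hT.le]
            exact continuousOn_finsetSum _ fun k _ => continuousOn_const.mul (hFc _))
            (by simp) hb
      _ = T * K₂ := by simp
      _ ≤ K₂ := mul_le_of_le_one_left (hK.K₂_nonneg hT) hT1

end Bounds

section Solution

variable {T : ℝ} {Φ : Data} {a : ℝ → ℝ} {u : ℝ → ℝ → ℝ} {K₁ K₂ K₃ : ℝ}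

lemma summable_freq_mul_of_envelope {f : ℕ → ℝ} {B : ℝ} (hf0 : ∀ k, 0 ≤ f k) {σ : ℕ → ℝ}
    (hf : ∀ k, f k ≤ freq k ^ 3 * σ k)
    (hσ : ∀ N, ∑ k ∈ Finset.range N, freq k ^ 3 * σ k ≤ B) : Summable f :=
  summable_of_sum_range_le hf0 fun N => (Finset.sum_le_sum fun k _ => hf k).trans (hσ N)

lemma IsClassicalSolution.hasSum_dx_zero (hT : 0 < T) (hT1 : T ≤ 1)
    (h : IsClassicalSolution T Φ a u) (hΦ : Φ.Admissible T) (hK : Φ.BoundedBy T K₁ K₂ K₃)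
    {t : ℝ} (ht : t ∈ Icc 0 T) :
    HasSum (fun k => 4 * (freq k * coeffY (fun x => u x t) (2 * (k + 1)))) (dx u 0 t) := by
  simp only [coeffY_even]
  refine hasSum_freq_mul_sinCoeff (f' := fun x => dx u x t) (h.continuousOn_slice ht)
    (fun x hx => h.hasDerivAt_x hx ht)
    (HeatInverse.continuousOn_slice h.u_C10.continuousOn_dx ht) (h.boundary_periodic t ht)
    (h.boundary_deriv t ht) ?_
  refine summable_freq_mul_of_envelope
    (fun k => mul_nonneg (freq_pos k).le (abs_nonneg _)) (fun k => ?_)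
    (Data.sum_freq_pow_mul_envelope_le hT hT1 hΦ hK)
  have h0 := h.coeffY_even_nonneg hT hΦ k ht
  have h1 := h.coeffY_even_le_envelope hT hΦ k ht
  rw [coeffY_even] at h0 h1
  rw [abs_of_nonneg h0]
  have := one_le_freq k
  exact mul_le_mul (by nlinarith [one_le_pow₀ (n := 2) this]) h1 h0 (by positivity)

lemma IsClassicalSolution.hasSum_moment (hT : 0 < T) (hT1 : T ≤ 1)
    (h : IsClassicalSolution T Φ a u) (hΦ : Φ.Admissible T) (hK : Φ.BoundedBy T K₁ K₂ K₃)
    {t : ℝ} (ht : t ∈ Icc 0 T) :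
    HasSum (fun k => 4 * (coeffY (fun x => u x t) (2 * (k + 1)) / freq k))
      (Φ.E t - 2 * coeffY (fun x => u x t) 0) := by
  rw [← h.overdetermination t ht]
  simp only [coeffY_even]
  refine hasSum_sinCoeff_div_freq (h.continuousOn_slice ht) ?_
  refine summable_freq_mul_of_envelope
    (fun k => div_nonneg (abs_nonneg _) (freq_pos k).le) (fun k => ?_)
    (Data.sum_freq_pow_mul_envelope_le hT hT1 hΦ hK)
  have h0 := h.coeffY_even_nonneg hT hΦ k ht
  have h1 := h.coeffY_even_le_envelope hT hΦ k ht
  rw [coeffY_even] at h0 h1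
  rw [abs_of_nonneg h0]
  have := one_le_freq k
  calc _ ≤ sinCoeff (fun x => u x t) k := div_le_self h0 this
    _ ≤ Φ.envelope T k := h1
    _ ≤ _ := le_mul_of_one_le_left (Data.envelope_nonneg hT hΦ k) (one_le_pow₀ this)

lemma integral_eq_sub_of_hasDerivWithinAt {f f' : ℝ → ℝ}
    (hf : ∀ t ∈ Icc 0 T, HasDerivWithinAt f (f' t) (Icc 0 T) t)
    (hf' : ContinuousOn f' (Icc 0 T)) {t : ℝ} (ht : t ∈ Icc 0 T) :
    ∫ τ in (0 : ℝ)..t, f' τ = f t - f 0 := by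
  have hsub : Icc 0 t ⊆ Icc 0 T := Icc_subset_Icc_right ht.2
  refine intervalIntegral.integral_eq_sub_of_hasDerivAt_of_le ht.1
    (fun τ hτ => ((hf τ (hsub hτ)).continuousWithinAt).mono hsub)
    (fun τ hτ => (hf τ (hsub (Ioo_subset_Icc_self hτ))).hasDerivAt
      (Icc_mem_nhds hτ.1 (hτ.2.trans_le ht.2))) ?_
  apply ContinuousOn.intervalIntegrable
  rw [uIcc_of_le ht.1]
  exact hf'.mono hsub

/-- The quantity `E - 2u_0` has derivative `E' - 2F_0 ≤ 0`, so it is smallest at `T`, and its value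
there is the gap: the series in the gap is `E(0) - 2u_0(0)` by the moment identity at `t = 0`. -/
lemma IsClassicalSolution.gap_le (hT : 0 < T) (hT1 : T ≤ 1)
    (h : IsClassicalSolution T Φ a u) (hΦ : Φ.Admissible T) (hK : Φ.BoundedBy T K₁ K₂ K₃)
    {t : ℝ} (ht : t ∈ Icc 0 T) : Φ.gap T ≤ Φ.E t - 2 * coeffY (fun x => u x t) 0 := by
  have h0 : (0 : ℝ) ∈ Icc 0 T := ⟨le_rfl, hT.le⟩
  have hFc := continuousOn_coeffY hT.le hΦ.a3.continuousOn 0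
  have hEc : ContinuousOn (derivWithin Φ.E (Icc 0 T)) (Icc 0 T) :=
    hΦ.a1.contDiffOn.continuousOn_derivWithin (uniqueDiffOn_Icc hT) le_rfl
  have hEd : ∀ t ∈ Icc 0 T, HasDerivWithinAt Φ.E (derivWithin Φ.E (Icc 0 T) t) (Icc 0 T) t :=
    fun t ht => (hΦ.a1.contDiffOn.differentiableOn one_ne_zero t ht).hasDerivWithinAt
  have hsum : ∑' k : ℕ, 2 / (Real.pi * (k + 1)) * coeffY Φ.φ (2 * (k + 1))
      = Φ.E 0 - 2 * coeffY (fun x => u x 0) 0 := by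
    rw [← (h.hasSum_moment hT hT1 hΦ hK h0).tsum_eq]
    refine tsum_congr fun k => ?_
    rw [h.coeffY_initial, freq]
    field_simp
    ring
  have hgap : Φ.gap T = Φ.E 0 - 2 * coeffY (fun x => u x 0) 0
      - ∫ t in (0 : ℝ)..T, (2 * coeffY (fun x => Φ.F x t) 0 - derivWithin Φ.E (Icc 0 T) t) := by
    rw [Data.gap, hsum, intervalIntegral.integral_sub, intervalIntegral.integral_const_mul]
    · ring
    · apply ContinuousOn.intervalIntegrable
      rw [uIcc_of_le hT.le]; exact continuousOn_const.mul hFc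
    · apply ContinuousOn.intervalIntegrable
      rwa [uIcc_of_le hT.le]
  have ht' := integral_eq_sub_of_hasDerivWithinAt
    (f := fun t => 2 * coeffY (fun x => u x t) 0 - Φ.E t)
    (fun t ht => ((h.hasDerivWithinAt_zero hT hΦ ht).const_mul 2).sub (hEd t ht))
    ((continuousOn_const.mul hFc).sub hEc) ht
  have hle := integral_le_integral_of_nonneg (f := fun t => 2 * coeffY (fun x => Φ.F x t) 0
    - derivWithin Φ.E (Icc 0 T) t) ((continuousOn_const.mul hFc).sub hEc) (fun t ht => by
      have h1 := hΦ.a3.coeff_nonneg 0 t ht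
      have h2 := hΦ.a1.deriv_neg t ht
      simp only [mul_zero] at h1
      linarith) ht
  linarith

/-- The series for `E - 2u_0` and for `u_x(0,t)` have the same nonnegative coefficients with weights
`1 / freq k ≤ freq k`, so they compare term by term. -/
lemma IsClassicalSolution.gap_le_dx_zero (hT : 0 < T) (hT1 : T ≤ 1)
    (h : IsClassicalSolution T Φ a u) (hΦ : Φ.Admissible T) (hK : Φ.BoundedBy T K₁ K₂ K₃)
    {t : ℝ} (ht : t ∈ Icc 0 T) : Φ.gap T ≤ dx u 0 t := by
  refine (h.gap_le hT hT1 hΦ hK ht).trans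
    (hasSum_le (fun k => ?_) (h.hasSum_moment hT hT1 hΦ hK ht) (h.hasSum_dx_zero hT hT1 hΦ hK ht))
  have h0 := h.coeffY_even_nonneg hT hΦ k ht
  have h1 := one_le_freq k
  have h2 := div_le_self h0 h1
  have h3 := le_mul_of_one_le_left h0 h1
  linarith

lemma IsClassicalSolution.a_le (hT : 0 < T) (hT1 : T ≤ 1)
    (h : IsClassicalSolution T Φ a u) (hΦ : Φ.Admissible T) (hK : Φ.BoundedBy T K₁ K₂ K₃)
    {δ : ℝ} (hδ : 0 < δ) (hgap : δ ≤ Φ.gap T) {t : ℝ} (ht : t ∈ Icc 0 T) :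
    a t ≤ (K₂ + K₃) / δ := by
  have h1 := hgap.trans (h.gap_le_dx_zero hT hT1 hΦ hK ht)
  have h2 := h.a_mul_dx_zero hT hΦ ht
  have h3 := (neg_le_abs _).trans (hK.E_le t ht)
  have h4 := (le_abs_self _).trans (abs_integral_le_of_abs_le (hK.abs_F_le ht))
  rw [le_div_iff₀ hδ]
  have := mul_le_mul_of_nonneg_left h1 (h.a_pos t ht).le
  linarith

lemma Compatible.abs_coeffY_even_le {f : ℝ → ℝ} (hf : Compatible f) {K : ℝ}
    (hK : ∀ j ≤ 4, ∀ x ∈ Icc (0 : ℝ) 1, |iteratedDerivWithin j f (Icc 0 1) x| ≤ K) (k : ℕ) :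
    |coeffY f (2 * (k + 1))| ≤ K / freq k ^ 4 := by
  rw [le_div_iff₀ (pow_pos (freq_pos k) 4), mul_comm, coeffY_even]
  exact hf.freq_pow_mul_abs_sinCoeff_le (hK 4 le_rfl) k

lemma Compatible.abs_coeffY_odd_le {f : ℝ → ℝ} (hf : Compatible f) {K : ℝ}
    (hK : ∀ j ≤ 4, ∀ x ∈ Icc (0 : ℝ) 1, |iteratedDerivWithin j f (Icc 0 1) x| ≤ K) (k : ℕ) :
    |coeffY f (2 * k + 1)| ≤ 12 * K / freq k ^ 4 := by
  rw [le_div_iff₀ (pow_pos (freq_pos k) 4), mul_comm]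
  exact hf.abs_freq_pow_mul_coeffY_odd_le hK k

lemma IsClassicalSolution.abs_coeffY_odd_le (hT : 0 < T) (hT1 : T ≤ 1)
    (h : IsClassicalSolution T Φ a u) (hΦ : Φ.Admissible T) (hK : Φ.BoundedBy T K₁ K₂ K₃)
    {L : ℝ} (hL : ∀ t ∈ Icc 0 T, a t ≤ L) (k : ℕ) {t : ℝ} (ht : t ∈ Icc 0 T) :
    |coeffY (fun x => u x t) (2 * k + 1)|
      ≤ 12 * (K₁ + K₂) / freq k ^ 4 + 2 * freq k * (L * Φ.envelope T k) := by
  have hω := freq_pos k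
  have hσ := Data.envelope_nonneg hT hΦ k
  have h0T : (0 : ℝ) ∈ Icc 0 T := ⟨le_rfl, hT.le⟩
  have hL0 : 0 ≤ L := (h.a_pos 0 h0T).le.trans (hL 0 h0T)
  have hK2 := hK.K₂_nonneg hT
  have := abs_le_of_hasDerivWithinAt (p := fun t => a t * freq k ^ 2)
    (fun t ht => h.hasDerivWithinAt_cos hT hΦ k ht)
    (fun t ht => mul_nonneg (h.a_pos t ht).le (sq_nonneg _))
    (c := 12 * K₁ / freq k ^ 4)
    (G := 2 * freq k * (L * Φ.envelope T k) + 12 * K₂ / freq k ^ 4) (fun t ht => by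
      refine (abs_add_le _ _).trans
        (add_le_add ?_ ((hΦ.compatible_F ht).abs_coeffY_odd_le (hK.F_le t ht) k))
      have hs0 := h.coeffY_even_nonneg hT hΦ k ht
      have ha := h.a_pos t ht
      rw [abs_neg, abs_of_nonneg (by positivity)]
      have := mul_le_mul (hL t ht) (h.coeffY_even_le_envelope hT hΦ k ht) hs0 hL0
      gcongr)
    (by rw [h.coeffY_initial]; exact hΦ.compatible_φ.abs_coeffY_odd_le hK.φ_le k) t ht
  have hG : 0 ≤ 2 * freq k * (L * Φ.envelope T k) + 12 * K₂ / freq k ^ 4 := by positivity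
  have h2 := mul_le_of_le_one_left hG hT1
  rw [mul_add, add_div]
  linarith

end Solution

/-! ### Estimates for the difference of two solutions. -/

lemma Data.Admissible.compatible_sub_φ {T : ℝ} {Φ Ψ : Data} (hΦ : Φ.Admissible T)
    (hΨ : Ψ.Admissible T) : Compatible (Φ - Ψ).φ :=
  hΦ.compatible_φ.sub hΨ.compatible_φ

lemma Data.Admissible.compatible_sub_F {T : ℝ} {Φ Ψ : Data} (hΦ : Φ.Admissible T)
    (hΨ : Ψ.Admissible T) {t : ℝ} (ht : t ∈ Icc 0 T) : Compatible fun x => (Φ - Ψ).F x t :=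
  (hΦ.compatible_F ht).sub (hΨ.compatible_F ht)

lemma Data.coeffY_sub_φ {T : ℝ} {Φ Ψ : Data} (hΦ : Φ.Admissible T) (hΨ : Ψ.Admissible T) (n : ℕ) :
    coeffY (Φ - Ψ).φ n = coeffY Φ.φ n - coeffY Ψ.φ n :=
  coeffY_sub hΦ.a2.contDiffOn.continuousOn hΨ.a2.contDiffOn.continuousOn n

lemma Data.coeffY_sub_F {T : ℝ} {Φ Ψ : Data} (hΦ : Φ.Admissible T) (hΨ : Ψ.Admissible T) {t : ℝ}
    (ht : t ∈ Icc 0 T) (n : ℕ) : coeffY (fun x => (Φ - Ψ).F x t) n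
      = coeffY (fun x => Φ.F x t) n - coeffY (fun x => Ψ.F x t) n :=
  coeffY_sub (hΦ.a3.contDiffOn t ht).continuousOn (hΨ.a3.contDiffOn t ht).continuousOn n

section Difference

variable {T : ℝ} {Φ Ψ : Data} {a b : ℝ → ℝ} {u v : ℝ → ℝ → ℝ} {K₁ K₂ K₃ D N : ℝ}

lemma abs_sub_coeffY_even_le (hT : 0 < T) (hT1 : T ≤ 1)
    (h : IsClassicalSolution T Φ a u) (h' : IsClassicalSolution T Ψ b v)
    (hΦ : Φ.Admissible T) (hΨ : Ψ.Admissible T) (hD : (Φ - Ψ).BoundedBy T D D D)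
    (hN : ∀ t ∈ Icc 0 T, |a t - b t| ≤ N) (k : ℕ) {t : ℝ} (ht : t ∈ Icc 0 T) :
    |coeffY (fun x => u x t) (2 * (k + 1)) - coeffY (fun x => v x t) (2 * (k + 1))|
      ≤ 2 * D / freq k ^ 4 + T * N * (freq k ^ 2 * Ψ.envelope T k) := by
  have hω := freq_pos k
  have hD0 := hD.K₁_nonneg
  have hN0 : 0 ≤ N := (abs_nonneg _).trans (hN t ht)
  have := abs_le_of_hasDerivWithinAt
    (d := fun t => coeffY (fun x => u x t) (2 * (k + 1)) - coeffY (fun x => v x t) (2 * (k + 1)))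
    -- Damping the difference with `a` leaves `-(a - b) freq k ^ 2 v_{2k}` as forcing, controlled by
    -- the envelope of `Ψ`. The factor `T` in front of `N` is kept, since it is what later permits
    -- absorption.
    (p := fun t => a t * freq k ^ 2)
    (g := fun t => -((a t - b t) * (freq k ^ 2 * coeffY (fun x => v x t) (2 * (k + 1))))
      + coeffY (fun x => (Φ - Ψ).F x t) (2 * (k + 1)))
    (fun t ht => ((h.hasDerivWithinAt_sin hT hΦ k ht).sub
      (h'.hasDerivWithinAt_sin hT hΨ k ht)).congr_deriv (by
        rw [Data.coeffY_sub_F hΦ hΨ ht]; ring))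
    (fun t ht => mul_nonneg (h.a_pos t ht).le (sq_nonneg _))
    (c := D / freq k ^ 4)
    (G := N * (freq k ^ 2 * Ψ.envelope T k) + D / freq k ^ 4) (fun t ht => by
      refine (abs_add_le _ _).trans
        (add_le_add ?_ ((hΦ.compatible_sub_F hΨ ht).abs_coeffY_even_le (hD.F_le t ht) k))
      have hs0 := h'.coeffY_even_nonneg hT hΨ k ht
      rw [abs_neg, abs_mul, abs_of_nonneg (mul_nonneg (sq_nonneg (freq k)) hs0)]
      have := h'.coeffY_even_le_envelope hT hΨ k ht
      have := hN t ht
      gcongr)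
    (by
      rw [h.coeffY_initial, h'.coeffY_initial, ← Data.coeffY_sub_φ hΦ hΨ]
      exact (hΦ.compatible_sub_φ hΨ).abs_coeffY_even_le hD.φ_le k) t ht
  have h2 : T * (D / freq k ^ 4) ≤ D / freq k ^ 4 := mul_le_of_le_one_left (by positivity) hT1
  have h3 : 2 * D / freq k ^ 4 = D / freq k ^ 4 + D / freq k ^ 4 := by ring
  rw [h3]
  linarith

lemma sum_freq_mul_bound_le (hT : 0 < T) (hT1 : T ≤ 1) (hΨ : Ψ.Admissible T)
    (hK : Ψ.BoundedBy T K₁ K₂ K₃) (hD0 : 0 ≤ D) (hN0 : 0 ≤ N) (n : ℕ) :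
    ∑ k ∈ Finset.range n,
      freq k * (2 * D / freq k ^ 4 + T * N * (freq k ^ 2 * Ψ.envelope T k))
      ≤ 2 * D + T * N * (K₁ + K₂) := by
  calc _ ≤ ∑ k ∈ Finset.range n,
        (2 * D * (1 / freq k ^ 2) + T * N * (freq k ^ 3 * Ψ.envelope T k)) := by
        refine Finset.sum_le_sum fun k _ => ?_
        have h1 := one_le_freq k
        have h0 := freq_pos k
        have e : freq k * (2 * D / freq k ^ 4) = 2 * D * (1 / freq k ^ 3) := by field_simp
        have : 1 / freq k ^ 3 ≤ 1 / freq k ^ 2 :=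
          one_div_le_one_div_of_le (by positivity) (pow_le_pow_right₀ h1 (by norm_num))
        have := mul_le_mul_of_nonneg_left this (by positivity : 0 ≤ 2 * D)
        rw [mul_add, e]
        linarith
    _ ≤ _ := by
        rw [Finset.sum_add_distrib, ← Finset.mul_sum, ← Finset.mul_sum]
        have h1 := mul_le_mul_of_nonneg_left (sum_one_div_freq_sq_le n) (by positivity : 0 ≤ 2 * D)
        have h2 := mul_le_mul_of_nonneg_left (Data.sum_freq_pow_mul_envelope_le hT hT1 hΨ hK n)
          (by positivity : 0 ≤ T * N)
        linarith

/-- Stability of `u_x(0,·)`. -/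
lemma abs_sub_dx_zero_le (hT : 0 < T) (hT1 : T ≤ 1)
    (h : IsClassicalSolution T Φ a u) (h' : IsClassicalSolution T Ψ b v)
    (hΦ : Φ.Admissible T) (hΨ : Ψ.Admissible T) (hΦK : Φ.BoundedBy T K₁ K₂ K₃)
    (hΨK : Ψ.BoundedBy T K₁ K₂ K₃) (hD : (Φ - Ψ).BoundedBy T D D D)
    (hN : ∀ t ∈ Icc 0 T, |a t - b t| ≤ N) {t : ℝ} (ht : t ∈ Icc 0 T) :
    |dx u 0 t - dx v 0 t| ≤ 4 * (2 * D + T * N * (K₁ + K₂)) := by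
  have hN0 : 0 ≤ N := (abs_nonneg _).trans (hN t ht)
  have hs := (h.hasSum_dx_zero hT hT1 hΦ hΦK ht).sub (h'.hasSum_dx_zero hT hT1 hΨ hΨK ht)
  rw [← Real.norm_eq_abs]
  refine le_of_tendsto hs.tendsto_sum_nat.norm (Filter.Eventually.of_forall fun n => ?_)
  refine (norm_sum_le _ _).trans ?_
  refine le_trans ?_ (mul_le_mul_of_nonneg_left
    (sum_freq_mul_bound_le hT hT1 hΨ hΨK hD.K₁_nonneg hN0 n) (by norm_num : (0 : ℝ) ≤ 4))
  rw [Finset.mul_sum]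
  refine Finset.sum_le_sum fun k _ => ?_
  rw [← mul_sub, ← mul_sub, Real.norm_eq_abs, abs_mul, abs_mul, abs_of_pos (freq_pos k),
    abs_of_pos (by norm_num : (0 : ℝ) < 4)]
  have := abs_sub_coeffY_even_le hT hT1 h h' hΦ hΨ hD hN k ht
  have := freq_pos k
  gcongr

/-- Stability of the coefficient `a`, up to a small multiple of its own deviation. -/
lemma abs_sub_coefficient_le (hT : 0 < T) (hT1 : T ≤ 1)
    (h : IsClassicalSolution T Φ a u) (h' : IsClassicalSolution T Ψ b v)
    (hΦ : Φ.Admissible T) (hΨ : Ψ.Admissible T) (hΦK : Φ.BoundedBy T K₁ K₂ K₃)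
    (hΨK : Ψ.BoundedBy T K₁ K₂ K₃) (hD : (Φ - Ψ).BoundedBy T D D D) {δ : ℝ}
    (hgap : δ ≤ Φ.gap T) {L : ℝ} (hL : ∀ t ∈ Icc 0 T, b t ≤ L)
    (hN : ∀ t ∈ Icc 0 T, |a t - b t| ≤ N) {t : ℝ} (ht : t ∈ Icc 0 T) :
    |a t - b t| * δ ≤ 2 * D + L * (4 * (2 * D + T * N * (K₁ + K₂))) := by
  have h1 := hgap.trans (h.gap_le_dx_zero hT hT1 hΦ hΦK ht)
  have h2 := h.a_mul_dx_zero hT hΦ ht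
  have h3 := h'.a_mul_dx_zero hT hΨ ht
  have h4 := abs_sub_dx_zero_le hT hT1 h h' hΦ hΨ hΦK hΨK hD hN ht
  have hb := h'.a_pos t ht
  have hE : derivWithin (Φ - Ψ).E (Icc 0 T) t
      = derivWithin Φ.E (Icc 0 T) t - derivWithin Ψ.E (Icc 0 T) t :=
    derivWithin_fun_sub (hΦ.a1.contDiffOn.differentiableOn one_ne_zero t ht)
      (hΨ.a1.contDiffOn.differentiableOn one_ne_zero t ht)
  have hF : ∫ x in (0 : ℝ)..1, (Φ - Ψ).F x t
      = (∫ x in (0 : ℝ)..1, Φ.F x t) - ∫ x in (0 : ℝ)..1, Ψ.F x t :=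
    intervalIntegral.integral_sub
      (intervalIntegrable_of_continuousOn (hΦ.a3.contDiffOn t ht).continuousOn)
      (intervalIntegrable_of_continuousOn (hΨ.a3.contDiffOn t ht).continuousOn)
  have b1 := hD.E_le t ht
  have b2 := abs_integral_le_of_abs_le (hD.abs_F_le ht)
  -- From `a u_x - b v_x = (a - b) u_x + b (u_x - v_x)` at `x = 0`: the first term is bounded below
  -- through the gap of `Φ`, the second is bounded through `b ≤ L`.
  have key : (a t - b t) * dx u 0 t = -derivWithin (Φ - Ψ).E (Icc 0 T) t
      + (∫ x in (0 : ℝ)..1, (Φ - Ψ).F x t) + -(b t * (dx u 0 t - dx v 0 t)) := by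
    rw [hE, hF]
    linear_combination h2 - h3
  have c1 : |(a t - b t) * dx u 0 t| ≤ D + D + L * (4 * (2 * D + T * N * (K₁ + K₂))) := by
    rw [key]
    refine (abs_add_le _ _).trans (add_le_add ((abs_add_le _ _).trans (add_le_add ?_ b2)) ?_)
    · rwa [abs_neg]
    · rw [abs_neg, abs_mul, abs_of_pos hb]
      exact mul_le_mul (hL t ht) h4 (abs_nonneg _) (hb.le.trans (hL t ht))
  rw [abs_mul] at c1
  have := mul_le_mul_of_nonneg_left (h1.trans (le_abs_self _)) (abs_nonneg (a t - b t))
  linarith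

lemma abs_sub_coeffY_odd_le (hT : 0 < T) (hT1 : T ≤ 1)
    (h : IsClassicalSolution T Φ a u) (h' : IsClassicalSolution T Ψ b v)
    (hΦ : Φ.Admissible T) (hΨ : Ψ.Admissible T)
    (hΨK : Ψ.BoundedBy T K₁ K₂ K₃) (hD : (Φ - Ψ).BoundedBy T D D D) {L : ℝ}
    (hLa : ∀ t ∈ Icc 0 T, a t ≤ L) (hLb : ∀ t ∈ Icc 0 T, b t ≤ L)
    (hN : ∀ t ∈ Icc 0 T, |a t - b t| ≤ N) (k : ℕ) {t : ℝ} (ht : t ∈ Icc 0 T) :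
    |coeffY (fun x => u x t) (2 * k + 1) - coeffY (fun x => v x t) (2 * k + 1)|
      ≤ 24 * D / freq k ^ 4
        + N * (freq k ^ 2 * (12 * (K₁ + K₂) / freq k ^ 4 + 2 * freq k * (L * Ψ.envelope T k))
          + 2 * freq k * Ψ.envelope T k)
        + 2 * freq k * (L * (2 * D / freq k ^ 4 + T * N * (freq k ^ 2 * Ψ.envelope T k))) := by
  have hω := freq_pos k
  have hD0 := hD.K₁_nonneg
  have hK10 := hΨK.K₁_nonneg
  have hK20 := hΨK.K₂_nonneg hT
  have hN0 : 0 ≤ N := (abs_nonneg _).trans (hN t ht)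
  have hL0 : 0 ≤ L := (h.a_pos t ht).le.trans (hLa t ht)
  have hσ := Data.envelope_nonneg hT hΨ k
  set η := 12 * (K₁ + K₂) / freq k ^ 4 + 2 * freq k * (L * Ψ.envelope T k) with hη
  set e := 2 * D / freq k ^ 4 + T * N * (freq k ^ 2 * Ψ.envelope T k) with he
  have hη0 : 0 ≤ η := by positivity
  have he0 : 0 ≤ e := by positivity
  have := abs_le_of_hasDerivWithinAt
    (d := fun t => coeffY (fun x => u x t) (2 * k + 1) - coeffY (fun x => v x t) (2 * k + 1))
    (p := fun t => a t * freq k ^ 2)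
    -- Three sources besides the data: `a - b` acts on the damping and on the coupling of `v`, and
    -- `a` transports the difference of the sine coefficients already estimated.
    (g := fun t => -((a t - b t) * (freq k ^ 2 * coeffY (fun x => v x t) (2 * k + 1)))
      + -((a t - b t) * (2 * freq k * coeffY (fun x => v x t) (2 * (k + 1))))
      + -(2 * freq k * (a t * (coeffY (fun x => u x t) (2 * (k + 1))
        - coeffY (fun x => v x t) (2 * (k + 1)))))
      + coeffY (fun x => (Φ - Ψ).F x t) (2 * k + 1))
    (fun t ht => ((h.hasDerivWithinAt_cos hT hΦ k ht).sub
      (h'.hasDerivWithinAt_cos hT hΨ k ht)).congr_deriv (by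
        rw [Data.coeffY_sub_F hΦ hΨ ht]; ring))
    (fun t ht => mul_nonneg (h.a_pos t ht).le (sq_nonneg _))
    (c := 12 * D / freq k ^ 4)
    (G := N * (freq k ^ 2 * η) + N * (2 * freq k * Ψ.envelope T k) + 2 * freq k * (L * e)
      + 12 * D / freq k ^ 4) (fun t ht => by
      have hs0 := h'.coeffY_even_nonneg hT hΨ k ht
      have ha := h.a_pos t ht
      have hNt := hN t ht
      have c1 := h'.abs_coeffY_odd_le hT hT1 hΨ hΨK hLb k ht
      have c2 := h'.coeffY_even_le_envelope hT hΨ k ht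
      have c3 := abs_sub_coeffY_even_le hT hT1 h h' hΦ hΨ hD hN k ht
      have c4 := hLa t ht
      rw [← hη] at c1
      rw [← he] at c3
      refine (abs_add_le _ _).trans
        (add_le_add ?_ ((hΦ.compatible_sub_F hΨ ht).abs_coeffY_odd_le (hD.F_le t ht) k))
      refine (abs_add_le _ _).trans (add_le_add ((abs_add_le _ _).trans (add_le_add ?_ ?_)) ?_)
      · rw [abs_neg, abs_mul, abs_mul, abs_of_pos (by positivity : 0 < freq k ^ 2)]
        gcongr
      · rw [abs_neg, abs_mul, abs_of_nonneg (by positivity :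
          0 ≤ 2 * freq k * coeffY (fun x => v x t) (2 * (k + 1)))]
        gcongr
      · rw [abs_neg, abs_mul (2 * freq k), abs_mul (a t),
          abs_of_pos (by positivity : 0 < 2 * freq k), abs_of_pos ha]
        gcongr)
    (by
      rw [h.coeffY_initial, h'.coeffY_initial, ← Data.coeffY_sub_φ hΦ hΨ]
      exact (hΦ.compatible_sub_φ hΨ).abs_coeffY_odd_le hD.φ_le k) t ht
  refine this.trans ?_
  refine (add_le_add_right (mul_le_of_le_one_left (by positivity) hT1) _).trans (le_of_eq ?_)
  ring

/-- Every envelope term carries at most `freq k ^ 3` and every other term at least `freq k ^ (-2)`.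
The constant `14 + 2L` collects `12` from the decay of the data and `2L + 2` from the envelope
terms. -/
lemma sum_bound_odd_le (hT : 0 < T) (hT1 : T ≤ 1) (hΨ : Ψ.Admissible T)
    (hK : Ψ.BoundedBy T K₁ K₂ K₃) (hD0 : 0 ≤ D) (hN0 : 0 ≤ N) {L : ℝ} (hL0 : 0 ≤ L) (n : ℕ) :
    ∑ k ∈ Finset.range n, (24 * D / freq k ^ 4
        + N * (freq k ^ 2 * (12 * (K₁ + K₂) / freq k ^ 4 + 2 * freq k * (L * Ψ.envelope T k))
          + 2 * freq k * Ψ.envelope T k)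
        + 2 * freq k * (L * (2 * D / freq k ^ 4 + T * N * (freq k ^ 2 * Ψ.envelope T k))))
      ≤ 24 * D + N * ((K₁ + K₂) * (14 + 2 * L)) + 2 * L * (2 * D + T * N * (K₁ + K₂)) := by
  have hK10 := hK.K₁_nonneg
  have hK20 := hK.K₂_nonneg hT
  calc _ ≤ ∑ k ∈ Finset.range n, (24 * D * (1 / freq k ^ 2)
        + (N * (12 * (K₁ + K₂)) * (1 / freq k ^ 2)
          + N * (2 * L + 2) * (freq k ^ 3 * Ψ.envelope T k))
        + 2 * L * (freq k * (2 * D / freq k ^ 4 + T * N * (freq k ^ 2 * Ψ.envelope T k)))) := by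
        refine Finset.sum_le_sum fun k _ => ?_
        have h1 := one_le_freq k
        have h0 := freq_pos k
        have hσ := Data.envelope_nonneg hT hΨ k
        refine add_le_add (add_le_add ?_ ?_) (le_of_eq (by ring))
        · rw [mul_one_div]
          gcongr 24 * D / ?_
          exact pow_le_pow_right₀ h1 (by norm_num)
        · have e : freq k ^ 2 * (12 * (K₁ + K₂) / freq k ^ 4 + 2 * freq k * (L * Ψ.envelope T k))
              = 12 * (K₁ + K₂) * (1 / freq k ^ 2) + 2 * L * (freq k ^ 3 * Ψ.envelope T k) := by
            field_simp
          have h3 : freq k * Ψ.envelope T k ≤ freq k ^ 3 * Ψ.envelope T k := by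
            gcongr
            exact le_self_pow₀ h1 (by norm_num)
          have h4 := mul_le_mul_of_nonneg_left h3 hN0
          rw [e]
          linarith
    _ ≤ _ := by
        simp only [Finset.sum_add_distrib, ← Finset.mul_sum]
        have h1 := sum_one_div_freq_sq_le n
        have h2 := Data.sum_freq_pow_mul_envelope_le hT hT1 hΨ hK n
        have h3 := sum_freq_mul_bound_le hT hT1 hΨ hK hD0 hN0 n
        have i1 := mul_le_mul_of_nonneg_left h1 (by positivity : 0 ≤ 24 * D)
        have i2 := mul_le_mul_of_nonneg_left h1 (by positivity : 0 ≤ N * (12 * (K₁ + K₂)))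
        have i3 := mul_le_mul_of_nonneg_left h2 (by positivity : 0 ≤ N * (2 * L + 2))
        have i4 := mul_le_mul_of_nonneg_left h3 (by positivity : 0 ≤ 2 * L)
        linarith

/-- Stability of `u`, in terms of the deviation of the coefficient. -/
lemma abs_sub_solution_le (hT : 0 < T) (hT1 : T ≤ 1)
    (h : IsClassicalSolution T Φ a u) (h' : IsClassicalSolution T Ψ b v)
    (hΦ : Φ.Admissible T) (hΨ : Ψ.Admissible T)
    (hΨK : Ψ.BoundedBy T K₁ K₂ K₃) (hD : (Φ - Ψ).BoundedBy T D D D) {L : ℝ}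
    (hLa : ∀ t ∈ Icc 0 T, a t ≤ L) (hLb : ∀ t ∈ Icc 0 T, b t ≤ L)
    (hN : ∀ t ∈ Icc 0 T, |a t - b t| ≤ N) {x t : ℝ} (hx : x ∈ Icc (0 : ℝ) 1) (ht : t ∈ Icc 0 T) :
    |u x t - v x t| ≤ 2 * (2 * D)
      + 4 * (24 * D + N * ((K₁ + K₂) * (14 + 2 * L)) + 2 * L * (2 * D + N * (K₁ + K₂)))
      + 4 * (2 * D + N * (K₁ + K₂)) := by
  have hD0 := hD.K₁_nonneg
  have hK10 := hΨK.K₁_nonneg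
  have hK20 := hΨK.K₂_nonneg hT
  have hN0 : 0 ≤ N := (abs_nonneg _).trans (hN t ht)
  have hL0 : 0 ≤ L := (h.a_pos t ht).le.trans (hLa t ht)
  have huc := h.continuousOn_slice ht
  have hvc := h'.continuousOn_slice ht
  have hTN : 2 * D + T * N * (K₁ + K₂) ≤ 2 * D + N * (K₁ + K₂) := by
    gcongr
    exact mul_le_of_le_one_left hN0 hT1
  refine abs_le_of_coeffY (w := fun x => u x t - v x t) (huc.sub hvc)
    (by rw [h.boundary_periodic t ht, h'.boundary_periodic t ht]) ?_ (fun n => ?_) (fun n => ?_) hx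
  · rw [coeffY_sub huc hvc]
    -- The coefficient against `Y 0` is undamped because `Y 0` is linear, so `a` does not enter its
    -- equation.
    have := abs_le_of_hasDerivWithinAt (p := fun _ => 0)
      (d := fun t => coeffY (fun x => u x t) 0 - coeffY (fun x => v x t) 0)
      (g := fun t => coeffY (fun x => (Φ - Ψ).F x t) 0) (c := D) (G := D)
      (fun t ht => ((h.hasDerivWithinAt_zero hT hΦ ht).sub
        (h'.hasDerivWithinAt_zero hT hΨ ht)).congr_deriv (by
          rw [Data.coeffY_sub_F hΦ hΨ ht]; ring))
      (fun _ _ => le_rfl) (fun t ht => abs_coeffY_zero_le (hD.abs_F_le ht))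
      (by
        rw [h.coeffY_initial, h'.coeffY_initial, ← Data.coeffY_sub_φ hΦ hΨ]
        exact abs_coeffY_zero_le hD.abs_φ_le) t ht
    have := mul_le_of_le_one_left hD0 hT1
    linarith
  · refine ((Finset.sum_le_sum fun k _ => ?_).trans
      (sum_bound_odd_le hT hT1 hΨ hΨK hD0 hN0 hL0 n)).trans ?_
    · rw [coeffY_sub huc hvc]
      exact abs_sub_coeffY_odd_le hT hT1 h h' hΦ hΨ hΨK hD hLa hLb hN k ht
    · gcongr
  · refine ((Finset.sum_le_sum fun k _ => ?_).trans
      (sum_freq_mul_bound_le hT hT1 hΨ hΨK hD0 hN0 n)).trans hTN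
    rw [coeffY_sub huc hvc]
    have hσ := Data.envelope_nonneg hT hΨ k
    have hω := freq_pos k
    exact (abs_sub_coeffY_even_le hT hT1 h h' hΦ hΨ hD hN k ht).trans
      (le_mul_of_one_le_left (by positivity) (one_le_freq k))

end Difference

/-! ### Passage from extended norms to pointwise bounds, and the final absorption. -/

lemma abs_le_of_supNorm_le {α : Type*} {s : Set α} {f : α → ℝ} {K : ℝ≥0} (h : supNorm s f ≤ K)
    {z : α} (hz : z ∈ s) : |f z| ≤ K := by
  have h1 : ‖f z‖ₑ ≤ K := (le_iSup₂ (f := fun z _ => ‖f z‖ₑ) z hz).trans h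
  rw [enorm_le_coe] at h1
  exact_mod_cast h1

lemma supNorm_le_of_abs_le {α : Type*} {s : Set α} {f : α → ℝ} {K : ℝ≥0}
    (h : ∀ z ∈ s, |f z| ≤ K) : supNorm s f ≤ K := by
  refine iSup₂_le fun z hz => ?_
  rw [enorm_le_coe]
  exact_mod_cast h z hz

lemma Data.boundedBy_of_norm_le {T : ℝ} {Φ : Data} {K₁ K₂ K₃ : ℝ≥0} (h₁ : normC4 Φ.φ ≤ K₁)
    (h₂ : normC40 T Φ.F ≤ K₂) (h₃ : normC1 T Φ.E ≤ K₃) : Φ.BoundedBy T K₁ K₂ K₃ where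
  φ_le j hj x hx := by
    refine abs_le_of_supNorm_le (le_trans ?_ h₁) hx
    exact Finset.single_le_sum (f := fun j => supNorm (Icc 0 1) (iteratedDerivWithin j Φ.φ (Icc 0 1)))
      (fun _ _ => zero_le) (Finset.mem_range.mpr (by omega))
  F_le t ht j hj x hx := by
    refine abs_le_of_supNorm_le (s := closedQ T)
      (f := fun z : ℝ × ℝ => iteratedDerivWithin j (fun y => Φ.F y z.2) (Icc 0 1) z.1)
      (le_trans ?_ h₂) (z := (x, t)) ⟨hx, ht⟩
    exact Finset.single_le_sum (f := fun j => supNorm (closedQ T)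
      (fun z : ℝ × ℝ => iteratedDerivWithin j (fun y => Φ.F y z.2) (Icc 0 1) z.1))
      (fun _ _ => zero_le) (Finset.mem_range.mpr (by omega))
  E_le t ht := abs_le_of_supNorm_le ((le_add_left le_rfl).trans h₃) ht

/-- Stability with explicit constants for data at finite distance. -/
theorem stability {T : ℝ} (hT : 0 < T) (hT1 : T ≤ 1) {Φ Ψ : Data} {a b : ℝ → ℝ}
    {u v : ℝ → ℝ → ℝ} {K₁ K₂ K₃ D δ L B C : ℝ} (hδ : 0 < δ)
    (hL : L = (K₂ + K₃) / δ) (hB : B = K₁ + K₂) (hC : C = 2 * (2 + 8 * L) / δ)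
    (hTδ : T * (8 * L * B + 1) ≤ δ)
    (h : IsClassicalSolution T Φ a u) (h' : IsClassicalSolution T Ψ b v)
    (hΦ : Φ.Admissible T) (hΨ : Ψ.Admissible T) (hΦK : Φ.BoundedBy T K₁ K₂ K₃)
    (hΨK : Ψ.BoundedBy T K₁ K₂ K₃) (hD : (Φ - Ψ).BoundedBy T D D D)
    (hΦδ : δ ≤ Φ.gap T) (hΨδ : δ ≤ Ψ.gap T) :
    (∀ t ∈ Icc 0 T, |a t - b t| ≤ C * D) ∧
      ∀ x ∈ Icc (0 : ℝ) 1, ∀ t ∈ Icc 0 T, |u x t - v x t| ≤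
        (4 + 4 * (24 + C * (B * (14 + 2 * L)) + 2 * L * (2 + C * B)) + 4 * (2 + C * B)) * D := by
  have h0T : (0 : ℝ) ∈ Icc 0 T := ⟨le_rfl, hT.le⟩
  have hLa : ∀ t ∈ Icc 0 T, a t ≤ L := fun t ht => hL ▸ h.a_le hT hT1 hΦ hΦK hδ hΦδ ht
  have hLb : ∀ t ∈ Icc 0 T, b t ≤ L := fun t ht => hL ▸ h'.a_le hT hT1 hΨ hΨK hδ hΨδ ht
  -- At a maximum point `τ` the bound `N` may be taken equal to the left-hand side, so the
  -- coefficient estimate becomes an inequality for `N` alone.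
  obtain ⟨τ, hτ, hmax⟩ := isCompact_Icc.exists_isMaxOn (f := fun t => |a t - b t|) ⟨0, h0T⟩
    (h.a_continuousOn.sub h'.a_continuousOn).abs
  have hmax' : ∀ t ∈ Icc 0 T, |a t - b t| ≤ |a τ - b τ| := fun t ht => hmax ht
  have key := abs_sub_coefficient_le hT hT1 h h' hΦ hΨ hΦK hΨK hD hΦδ hLb hmax' hτ
  have hτC : |a τ - b τ| ≤ C * D := by
    set N := |a τ - b τ| with hN
    have hN0 : 0 ≤ N := abs_nonneg _
    -- The estimate reads `N δ ≤ (2 + 8L) D + 4 L B T N`; here the last term is at most `N δ / 2`,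
    -- which gives the value of `C`.
    have h1 : N * (T * (8 * L * B + 1)) ≤ N * δ := mul_le_mul_of_nonneg_left hTδ hN0
    have h2 : 0 ≤ N * T := mul_nonneg hN0 hT.le
    rw [← hB] at key
    rw [hC, div_mul_eq_mul_div, le_div_iff₀ hδ]
    linarith
  have hCD : ∀ t ∈ Icc 0 T, |a t - b t| ≤ C * D := fun t ht => (hmax' t ht).trans hτC
  refine ⟨hCD, fun x hx t ht => ?_⟩
  refine (abs_sub_solution_le hT hT1 h h' hΦ hΨ hΨK hD hLa hLb hCD hx ht).trans (le_of_eq ?_)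
  rw [← hB]
  ring

end HeatInverse

theorem mainTheorem2 (M₁ M₂ M₃ : ℝ≥0) (δ : ℝ) (hδ : 0 < δ) :
    ∃ T₀ : ℝ, 0 < T₀ ∧ ∃ M₁₃ M₁₄ : ℝ≥0,
      ∀ T : ℝ, 0 < T → T ≤ T₀ →
      ∀ Φ Ψ : HeatInverse.Data, Φ.Admissible T → Ψ.Admissible T →
        HeatInverse.normC4 Φ.φ ≤ M₁ → HeatInverse.normC40 T Φ.F ≤ M₂ →
        HeatInverse.normC1 T Φ.E ≤ M₃ →
        HeatInverse.normC4 Ψ.φ ≤ M₁ → HeatInverse.normC40 T Ψ.F ≤ M₂ →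
        HeatInverse.normC1 T Ψ.E ≤ M₃ →
        δ ≤ Φ.gap T → δ ≤ Ψ.gap T →
      ∀ (a b : ℝ → ℝ) (u v : ℝ → ℝ → ℝ),
        HeatInverse.IsClassicalSolution T Φ a u → HeatInverse.IsClassicalSolution T Ψ b v →
        HeatInverse.supNorm (Icc 0 T) (fun t => a t - b t) ≤ M₁₃ * (Φ - Ψ).norm T ∧
        HeatInverse.supNorm (HeatInverse.closedQ T) (fun z => u z.1 z.2 - v z.1 z.2)
          ≤ M₁₄ * (Φ - Ψ).norm T := by
  obtain ⟨L, hL⟩ : ∃ L : ℝ, L = ((M₂ : ℝ) + M₃) / δ := ⟨_, rfl⟩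
  obtain ⟨B, hB⟩ : ∃ B : ℝ, B = (M₁ : ℝ) + M₂ := ⟨_, rfl⟩
  obtain ⟨C, hC⟩ : ∃ C : ℝ, C = 2 * (2 + 8 * L) / δ := ⟨_, rfl⟩
  have hL0 : 0 ≤ L := by rw [hL]; positivity
  have hB0 : 0 ≤ B := by rw [hB]; positivity
  have hC0 : 0 < C := by rw [hC]; positivity
  have hP : 0 < 8 * L * B + 1 := by positivity
  have hC' : 0 < 4 + 4 * (24 + C * (B * (14 + 2 * L)) + 2 * L * (2 + C * B)) + 4 * (2 + C * B) := by
    positivity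
  obtain ⟨m, hm⟩ : ∃ m : ℝ≥0, (m : ℝ) = C := ⟨C.toNNReal, Real.coe_toNNReal _ hC0.le⟩
  obtain ⟨m', hm'⟩ : ∃ m' : ℝ≥0, (m' : ℝ)
      = 4 + 4 * (24 + C * (B * (14 + 2 * L)) + 2 * L * (2 + C * B)) + 4 * (2 + C * B) :=
    ⟨Real.toNNReal _, Real.coe_toNNReal _ hC'.le⟩
  -- The summand `1` keeps the denominator positive when `L * B = 0`.
  refine ⟨min 1 (δ / (8 * L * B + 1)), lt_min one_pos (div_pos hδ hP), m, m', ?_⟩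
  intro T hT hTT Φ Ψ hΦ hΨ hΦ1 hΦ2 hΦ3 hΨ1 hΨ2 hΨ3 hΦδ hΨδ a b u v h h'
  -- If the distance is infinite, the right-hand sides are infinite because both constants are
  -- nonzero; this spares a triangle inequality for the norms.
  rcases eq_or_ne ((Φ - Ψ).norm T) ⊤ with htop | htop
  · rw [htop, ENNReal.mul_top, ENNReal.mul_top]
    · exact ⟨le_top, le_top⟩
    · rw [ENNReal.coe_ne_zero, ← NNReal.coe_ne_zero, hm']; exact hC'.ne'
    · rw [ENNReal.coe_ne_zero, ← NNReal.coe_ne_zero, hm]; exact hC0.ne'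
  · lift (Φ - Ψ).norm T to ℝ≥0 using htop with D hDnorm
    have hD : (Φ - Ψ).BoundedBy T D D D := by
      apply HeatInverse.Data.boundedBy_of_norm_le <;> rw [hDnorm, HeatInverse.Data.norm]
      · exact le_add_right (le_add_right le_rfl)
      · exact le_add_right (le_add_left le_rfl)
      · exact le_add_left le_rfl
    have hTδ : T * (8 * L * B + 1) ≤ δ := (le_div_iff₀ hP).mp (hTT.trans (min_le_right _ _))
    obtain ⟨ha, hu⟩ := HeatInverse.stability hT (hTT.trans (min_le_left _ _)) hδ hL hB hC hTδ h h'
      hΦ hΨ (HeatInverse.Data.boundedBy_of_norm_le hΦ1 hΦ2 hΦ3)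
      (HeatInverse.Data.boundedBy_of_norm_le hΨ1 hΨ2 hΨ3) hD hΦδ hΨδ
    rw [← ENNReal.coe_mul, ← ENNReal.coe_mul]
    refine ⟨HeatInverse.supNorm_le_of_abs_le fun t ht => ?_,
      HeatInverse.supNorm_le_of_abs_le fun z hz => ?_⟩
    · rw [NNReal.coe_mul, hm]
      exact ha t ht
    · rw [NNReal.coe_mul, hm']
      exact hu z.1 hz.1 z.2 hz.2
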